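/- Let $\mathcal H$ be a separable Hilbert space, $\mathscr Y$ a compact Riemannian manifold without boundary, $\mathscr H=\mathcal H\times\mathscr Y$ (with a product distance $d_{\mathscr H}$), $\mathscr E$ a separable Banach space, and $S:\mathscr H\times\mathscr E\to\mathscr H$ a continuous map. Let $\{\eta_k\}_{k\ge1}$ be i.i.d. $\mathscr E$-valued random variables with law $\ell$, let $\mathcal K=\operatorname{supp}\ell$, and consider the random dynamical system $$\Upsilon_k=S(\Upsilon_{k-1},\eta_k),\qquad k\ge1. \tag{1}$$ Write $S_n(\Upsilon;\zeta_1,\dots,\zeta_n)$ for the value $\Upsilon_n$ obtained from (1) with $\Upsilon_0=\Upsilon$ and $\eta_k=\zeta_k$. Let $\mathcal A\subset\mathcal H$ be a compact set such that $\mathscr X:=\mathcal A\times\mathscr Y$ satisfies $S(\mathscr X\times\mathcal K)\subset\mathscr X$. Assume the following. * **(R)** There is a Banach space $\mathcal V$ compactly embedded into $\mathcal H$ such that the image of $S$ is contained in $\mathscr V:=\mathcal V\times\mathscr Y$, and $S:\mathscr H\times\mathscr E\to\mathscr V$ is twice continuously differentiable with derivatives of orders one and two bounded on bounded subsets. Moreover,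 there is $\overline\Upsilon\in\mathscr X$ with $S(\overline\Upsilon,0)=\overline\Upsilon$. * **(AC)** For any $\varepsilon>0$ there is an integer $n\ge1$ such that for all $\Upsilon,\widehat\Upsilon\in\mathscr X$ there are $\zeta_1,\dots,\zeta_n\in\mathcal K$ with $d_{\mathscr H}\bigl(S_n(\Upsilon;\zeta_1,\dots,\zeta_n),\widehat\Upsilon\bigr)\le\varepsilon$. * **(ACL)** For any $\Upsilon\in\mathscr X$ and $\eta\in\mathcal K$, the derivative $(D_\eta S)(\Upsilon,\eta):\mathscr E\to\mathcal H\times T_y\mathscr Y$, where $y$ is the $\mathscr Y$-component of $S(\Upsilon,\eta)$, has dense image. * **(D)** $\mathcal K$ is compact, and there are closed subspaces $\mathscr F_n,\mathscr G_n\subset\mathscr E$, $n\ge1$, such that $\dim\mathscr F_n<\infty$, $\mathscr F_n\subset\mathscr F_{n+1}$, $\bigcup_n\mathscr F_n$ is dense in $\mathscr E$, $\mathscr E=\mathscr F_n\oplus\mathscr G_n$ with the norms of the corresponding projections $\mathsf P_n$ and $\mathsf Q_n$ bounded uniformly in $n$, the measure $\ell$ is the product of its projections $\mathsf P_{n*}\ell$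 and $\mathsf Q_{n*}\ell$, and $\mathsf P_{n*}\ell$ has a $C^1$ density with respect to Lebesgue measure on $\mathscr F_n$. Let $P_1(\Upsilon,\Gamma)=\ell\{\zeta: S(\Upsilon,\zeta)\in\Gamma\}$ be the transition function of (1) on $\mathscr X$, let $\mathfrak P_1^*\nu=\int_{\mathscr X}P_1(\Upsilon,\cdot)\,\nu(d\Upsilon)$, and let $\mathfrak P_k^*$ be its $k$-th iterate, acting on the space $\mathcal P(\mathscr X)$ of Borel probability measures. For $\mu,\nu\in\mathcal P(\mathscr X)$ let $$\|\mu-\nu\|_L^*=\sup_{\|f\|_L\le1}\Bigl|\int f\,d\mu-\int f\,d\nu\Bigr|,\qquad \|f\|_L=\sup_{u}|f(u)|+\sup_{u\ne v}\frac{|f(u)-f(v)|}{d_{\mathscr H}(u,v)},$$ where $f$ ranges over real functions on $\mathscr X$. **Theorem.** Under these assumptions, the Markov process associated with (1) has a unique stationary measure $\mu\in\mathcal P(\mathscr X)$, i.e. a unique $\mu\in\mathcal P(\mathscr X)$ with $\mathfrak P_1^*\mu=\mu$. Moreover, there are positive numbers $\gamma$ and $C$ such that $$\|\mathfrak P_k^*\nu-\mu\|_L^*\le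 C e^{-\gamma k}\qquad\text{for all }\nu\in\mathcal P(\mathscr X),\ k\ge0.$$ -/

import Mathlib

open MeasureTheory Set Filter Topology Manifold Bundle
open scoped ENNReal NNReal ContDiff

noncomputable section

namespace ControlledRDS

section Dynamics

variable {𝓗 𝓨 𝓔 : Type*}

/-- The phase space `𝓧 = 𝓐 × 𝓨`, as a subset of `𝓗 × 𝓨`. -/
def phaseSet (𝓨 : Type*) (𝓐 : Set 𝓗) : Set (𝓗 × 𝓨) := 𝓐 ×ˢ univ

/-- The trajectory `Υ_k = S (Υ_{k-1}, η_k)`, `Υ_0 = x`, where `ζ j` plays the role of `η_{j+1}`;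
the value at `k` is `S_k(x; η_1, …, η_k)`. -/
def trajectory (S : (𝓗 × 𝓨) × 𝓔 → 𝓗 × 𝓨) (x : 𝓗 × 𝓨) (ζ : ℕ → 𝓔) : ℕ → 𝓗 × 𝓨
  | 0 => x
  | k + 1 => S (trajectory S x ζ k, ζ k)

/-- The transition function `P_1(Υ, ·) = S_*(Υ, ℓ)` restricted to `𝓧`: the measure of
`Γ ⊆ 𝓧` is `ℓ {ζ | S (Υ, ζ) ∈ Γ}`. -/
def transition [MeasurableSpace 𝓗] [MeasurableSpace 𝓨] [MeasurableSpace 𝓔]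
    (S : (𝓗 × 𝓨) × 𝓔 → 𝓗 × 𝓨) (ℓ : Measure 𝓔) (𝓐 : Set 𝓗)
    (x : phaseSet 𝓨 𝓐) : Measure (phaseSet 𝓨 𝓐) :=
  (ℓ.map fun ζ => S ((x : 𝓗 × 𝓨), ζ)).comap Subtype.val

/-- The Markov operator on measures, `(𝔓_1^* ν)(Γ) = ∫ P_1(Υ, Γ) ν(dΥ)`. The operator `𝔓_k^*` is
its `k`-th iterate. -/
def markovDual [MeasurableSpace 𝓗] [MeasurableSpace 𝓨] [MeasurableSpace 𝓔]
    (S : (𝓗 × 𝓨) × 𝓔 → 𝓗 × 𝓨) (ℓ : Measure 𝓔) (𝓐 : Set 𝓗)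
    (ν : Measure (phaseSet 𝓨 𝓐)) : Measure (phaseSet 𝓨 𝓐) :=
  ν.bind (transition S ℓ 𝓐)

/-- A stationary measure: a probability measure on `𝓧` with `𝔓_1^* μ = μ`. -/
def IsStationary [MeasurableSpace 𝓗] [MeasurableSpace 𝓨] [MeasurableSpace 𝓔]
    (S : (𝓗 × 𝓨) × 𝓔 → 𝓗 × 𝓨) (ℓ : Measure 𝓔) (𝓐 : Set 𝓗)
    (μ : Measure (phaseSet 𝓨 𝓐)) : Prop :=
  IsProbabilityMeasure μ ∧ markovDual S ℓ 𝓐 μ = μ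

end Dynamics

section DualLipschitz

variable {X : Type*} [EMetricSpace X]

/-- `‖f‖_L = sup |f| + sup_{u ≠ v} |f u - f v| / d(u, v)`, with values in `[0, ∞]`. The terms with
`u = v` vanish because `0 / 0 = 0`, and so do those with `d(u, v) = ∞`. -/
def lipNorm (f : X → ℝ) : ℝ≥0∞ :=
  (⨆ u, ‖f u‖ₑ) + ⨆ u, ⨆ v, edist (f u) (f v) / edist u v

/-- The dual-Lipschitz distance `sup_{‖f‖_L ≤ 1} |⟨f, μ⟩ - ⟨f, ν⟩|`, with values in `[0, ∞]`. -/
def dualLipDist [MeasurableSpace X] (μ ν : Measure X) : ℝ≥0∞ :=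
  ⨆ f : {f : X → ℝ // lipNorm f ≤ 1},
    ENNReal.ofReal |(∫ u, f.1 u ∂μ) - ∫ u, f.1 u ∂ν|

end DualLipschitz

section Regularity

variable {𝓗 : Type*} [NormedAddCommGroup 𝓗] [InnerProductSpace ℝ 𝓗]
  {d : ℕ} {𝓨 : Type*} [TopologicalSpace 𝓨] [ChartedSpace (EuclideanSpace ℝ (Fin d)) 𝓨]
  {𝓔 : Type*} [NormedAddCommGroup 𝓔] [NormedSpace ℝ 𝓔]
  {𝓥 : Type*} [NormedAddCommGroup 𝓥] [NormedSpace ℝ 𝓥]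

/-- The map `T : 𝓗 × 𝓨 × 𝓔 → 𝓥 × 𝓨` read in the charts of `𝓨` at `y₀` (in the source) and
at `z₀` (in the target). -/
def localRep (T : (𝓗 × 𝓨) × 𝓔 → 𝓥 × 𝓨) (y₀ z₀ : 𝓨) :
    (𝓗 × EuclideanSpace ℝ (Fin d)) × 𝓔 → 𝓥 × EuclideanSpace ℝ (Fin d) :=
  fun p =>
    let q := T ((p.1.1, (extChartAt (𝓡 d) y₀).symm p.1.2), p.2)
    (q.1, extChartAt (𝓡 d) z₀ q.2)

/-- The derivatives of `T` of orders one and two are bounded on bounded subsets of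
`𝓗 × 𝓨 × 𝓔` (with `𝓨` compact): in local coordinates near any two points `y₀`, `z₀` of `𝓨`, they
are bounded uniformly over balls of `𝓗` and `𝓔`. Since changes of coordinates have locally bounded
derivatives, this does not depend on the choice of charts. -/
def DerivativesBounded (T : (𝓗 × 𝓨) × 𝓔 → 𝓥 × 𝓨) : Prop :=
  ∀ (R : ℝ) (y₀ z₀ : 𝓨), ∃ U ∈ 𝓝 y₀, ∃ W ∈ 𝓝 z₀, ∃ C : ℝ,
    ∀ (u : 𝓗) (y : 𝓨) (η : 𝓔), ‖u‖ ≤ R → ‖η‖ ≤ R → y ∈ U → (T ((u, y), η)).2 ∈ W →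
      ‖iteratedFDeriv ℝ 1 (localRep (d := d) T y₀ z₀) ((u, extChartAt (𝓡 d) y₀ y), η)‖ ≤ C ∧
      ‖iteratedFDeriv ℝ 2 (localRep (d := d) T y₀ z₀) ((u, extChartAt (𝓡 d) y₀ y), η)‖ ≤ C

/-- Hypothesis (R), for a Banach space `𝓥` with embedding `ι : 𝓥 → 𝓗`. -/
structure HypR (d : ℕ) [ChartedSpace (EuclideanSpace ℝ (Fin d)) 𝓨]
    (S : (𝓗 × 𝓨) × 𝓔 → 𝓗 × 𝓨) (𝓐 : Set 𝓗) (ι : 𝓥 →L[ℝ] 𝓗) : Prop where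
  embedding : Function.Injective ι
  compact : IsCompactOperator ι
  /-- `S` takes values in `𝓥 × 𝓨`, and is `C²` with bounded derivatives as a map into it. -/
  smooth : ∃ T : (𝓗 × 𝓨) × 𝓔 → 𝓥 × 𝓨,
    (∀ p, S p = (ι (T p).1, (T p).2)) ∧
    ContMDiff ((𝓘(ℝ, 𝓗).prod (𝓡 d)).prod 𝓘(ℝ, 𝓔)) (𝓘(ℝ, 𝓥).prod (𝓡 d)) 2 T ∧
    DerivativesBounded (d := d) T
  fixedPoint : ∃ x ∈ phaseSet 𝓨 𝓐, S (x, 0) = x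

/-- Hypothesis (ACL): for `Υ ∈ 𝓧` and `η ∈ 𝓚`, the derivative
`(D_η S)(Υ, η) : 𝓔 → 𝓗 × T_y 𝓨` has dense image. -/
def HypACL (d : ℕ) [ChartedSpace (EuclideanSpace ℝ (Fin d)) 𝓨]
    (S : (𝓗 × 𝓨) × 𝓔 → 𝓗 × 𝓨) (𝓐 : Set 𝓗) (𝓚 : Set 𝓔) : Prop :=
  ∀ x ∈ phaseSet 𝓨 𝓐, ∀ η ∈ 𝓚,
    DenseRange (mfderiv 𝓘(ℝ, 𝓔) (𝓘(ℝ, 𝓗).prod (𝓡 d)) (fun ζ => S (x, ζ)) η)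

end Regularity

/-- Hypothesis (AC): approximate controllability in `𝓧` by controls from `𝓚`, in a time that depends
only on the precision. -/
def HypAC {𝓗 𝓨 𝓔 : Type*} [PseudoEMetricSpace 𝓗] [PseudoEMetricSpace 𝓨]
    (S : (𝓗 × 𝓨) × 𝓔 → 𝓗 × 𝓨) (𝓐 : Set 𝓗) (𝓚 : Set 𝓔) : Prop :=
  ∀ ε : ℝ, 0 < ε → ∃ n : ℕ, 1 ≤ n ∧ ∀ x ∈ phaseSet 𝓨 𝓐, ∀ x' ∈ phaseSet 𝓨 𝓐,
    ∃ ζ : ℕ → 𝓔, (∀ k < n, ζ k ∈ 𝓚) ∧ edist (trajectory S x ζ n) x' ≤ ENNReal.ofReal ε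

/-- Hypothesis (D): decomposability of the law `ℓ` of the noise. Here `P_n`, `Q_n` are the projections
associated with the direct sum `𝓔 = F n ⊕ G n`, regarded as maps to `F n` and `G n`. -/
structure HypD {𝓔 : Type*} [NormedAddCommGroup 𝓔] [NormedSpace ℝ 𝓔] [MeasurableSpace 𝓔]
    (ℓ : Measure 𝓔) : Prop where
  compact_support : IsCompact ℓ.support
  decomposition : ∃ F G : ℕ → Submodule ℝ 𝓔,
    (∀ n, IsClosed (G n : Set 𝓔)) ∧
    (∀ n, FiniteDimensional ℝ (F n)) ∧
    Monotone F ∧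
    Dense (⋃ n, (F n : Set 𝓔)) ∧
    ∃ h : ∀ n, IsCompl (F n) (G n),
      (∃ C : ℝ, ∀ n v, ‖(F n).projectionOnto (G n) (h n) v‖ ≤ C * ‖v‖ ∧
        ‖(G n).projectionOnto (F n) (h n).symm v‖ ≤ C * ‖v‖) ∧
      (∀ n, ℓ.map (fun v => ((F n).projectionOnto (G n) (h n) v,
          (G n).projectionOnto (F n) (h n).symm v)) =
        (ℓ.map ((F n).projectionOnto (G n) (h n))).prod
          (ℓ.map ((G n).projectionOnto (F n) (h n).symm))) ∧
      -- a Haar measure is a multiple of Lebesgue measure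
      ∀ n, ∃ (m : Measure (F n)) (ρ : F n → ℝ), m.IsAddHaarMeasure ∧ ContDiff ℝ 1 ρ ∧
        (∀ v, 0 ≤ ρ v) ∧
        ℓ.map ((F n).projectionOnto (G n) (h n)) = m.withDensity fun v => ENNReal.ofReal (ρ v)

end ControlledRDS

end

/-! The Markov operator `P` on functions contracts, after finitely many steps, the Lipschitz
seminorm of the truncated distance `d_K = min 1 (K d)`. By duality all initial laws then merge
exponentially fast, which gives uniqueness and mixing. Two mechanisms produce the contraction, one
for pairs with `d_K < 1` and one for pairs with `d_K = 1`.

Close points (`exists_truncDist_contraction`): in charts, the derivative of `S` in the state is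
compact, as it factors through `ι × id`, and by (ACL) its derivative in the noise has dense range. A
change from `x` to `x'` can therefore be compensated, up to the error `d(x, x') / 2`, by a shift `θ`
of the noise in a fixed finite-dimensional `F N`, of size `O(d(x, x'))` and independent of the noise
(`exists_local_contraction`). By (D) such a shift costs only `O(‖θ‖)` in total variation
(`exists_translation_bound`). If `f` is `a`-Lipschitz for `d_K`, it is `aK`-Lipschitz for `d` and
oscillates by at most `a`, so `P f` varies by at most `(aK / 2 + C a) d(x, x')`. For `K ≥ 4 C` this
is `3/4` of the original bound: the total variation error is absorbed by a steep metric.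

Distant points (`exists_oscillation_bound`): by (AC) all points reach a small ball at the same time
`n`, with a probability bounded below by compactness. On this ball `f` is almost constant, so `P^n`
shrinks oscillations by a fixed factor.

Existence comes from a cluster point of the iterates of a Dirac mass (`exists_stationary`). -/

set_option linter.unusedSectionVars false

/-! ### Markov operators of continuous random maps on compact spaces -/

namespace RandomMap

variable {X Z : Type*} [EMetricSpace X] [CompactSpace X] [MeasurableSpace X] [BorelSpace X]
  [TopologicalSpace Z] [CompactSpace Z] [SecondCountableTopology Z] [MeasurableSpace Z]
  [BorelSpace Z]

/-- The Markov operator on functions of the random map `s (·, ζ)`, with `ζ` of law `m`. -/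
noncomputable def markovOp (s : X × Z → X) (m : Measure Z) (f : X → ℝ) (x : X) : ℝ := ∫ z, f (s (x, z)) ∂m

/-- The Markov operator on measures of the random map `s (·, ζ)`, with `ζ` of law `m`. -/
noncomputable def markovPush (s : X × Z → X) (m : Measure Z) (ν : Measure X) : Measure X := (ν.prod m).map s

/-- The orbit of `x` under the random map, driven by the sequence `ζ`. -/
def orbit (s : X × Z → X) (x : X) (ζ : ℕ → Z) : ℕ → X
  | 0 => x
  | k + 1 => s (orbit s x ζ k, ζ k)

/-- The truncated distance `min 1 (K d(x, y))`. -/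
noncomputable def truncDist {X : Type*} [EMetricSpace X] (K : ℝ≥0) (x y : X) : ℝ :=
  (min 1 ((K : ℝ≥0∞) * edist x y)).toReal

/-- `f` is `a`-Lipschitz for the truncated distance. -/
def TruncLip {X : Type*} [EMetricSpace X] (K : ℝ≥0) (a : ℝ) (f : X → ℝ) : Prop :=
  ∀ x y, |f x - f y| ≤ a * truncDist K x y

section Trunc

variable {X : Type*} [EMetricSpace X] {K : ℝ≥0} {a : ℝ} {f : X → ℝ}

lemma truncDist_nonneg (x y : X) : 0 ≤ truncDist K x y := ENNReal.toReal_nonneg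

lemma truncDist_le_one (x y : X) : truncDist K x y ≤ 1 :=
  ENNReal.toReal_le_of_le_ofReal zero_le_one (by simp)

lemma truncDist_self (x : X) : truncDist K x x = 0 := by simp [truncDist]

lemma truncDist_of_one_le {x y : X} (h : 1 ≤ (K : ℝ≥0∞) * edist x y) : truncDist K x y = 1 := by
  simp [truncDist, min_eq_left h]

lemma truncDist_of_lt_one {x y : X} (h : (K : ℝ≥0∞) * edist x y < 1) :
    truncDist K x y = K * (edist x y).toReal := by
  simp [truncDist, min_eq_right h.le]

lemma truncDist_le {x y : X} (h : edist x y ≠ ⊤) :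
    truncDist K x y ≤ K * (edist x y).toReal := by
  have := ENNReal.toReal_mono (ENNReal.mul_ne_top ENNReal.coe_ne_top h)
    (min_le_right 1 ((K : ℝ≥0∞) * edist x y))
  simpa [truncDist] using this

lemma continuous_truncDist (y : X) : Continuous fun x => truncDist K x y := by
  rw [continuous_iff_continuousAt]
  intro x
  refine (ENNReal.tendsto_toReal ?_).comp ?_
  · exact ne_top_of_le_ne_top ENNReal.one_ne_top (min_le_left _ _)
  · have : Continuous fun x : X => min 1 ((K : ℝ≥0∞) * edist x y) :=
      continuous_const.min ((ENNReal.continuous_const_mul ENNReal.coe_ne_top).comp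
        (continuous_id.edist continuous_const))
    exact this.continuousAt

lemma TruncLip.mono {b : ℝ} (hf : TruncLip K a f) (hab : a ≤ b) : TruncLip K b f :=
  fun x y => (hf x y).trans (mul_le_mul_of_nonneg_right hab (truncDist_nonneg _ _))

lemma TruncLip.abs_sub_le (ha : 0 ≤ a) (hf : TruncLip K a f) (x y : X) : |f x - f y| ≤ a :=
  (hf x y).trans (mul_le_of_le_one_right ha (truncDist_le_one _ _))

lemma TruncLip.continuous (hf : TruncLip K a f) : Continuous f := by
  rw [continuous_iff_continuousAt]
  intro y
  have h0 : Tendsto (fun x => a * truncDist K x y) (𝓝 y) (𝓝 0) := by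
    have := ((continuous_truncDist (K := K) y).const_mul a).tendsto y
    simpa [truncDist_self] using this
  rw [ContinuousAt, tendsto_iff_norm_sub_tendsto_zero]
  exact squeeze_zero (fun _ => norm_nonneg _) (fun x => hf x y) h0

end Trunc

variable {s : X × Z → X} {m : Measure Z} [IsProbabilityMeasure m]

lemma integrable_comp_randomMap (hs : Continuous s) {f : X → ℝ} (hf : Continuous f) (x : X) :
    Integrable (fun z => f (s (x, z))) m := by
  have hc : Continuous fun z => f (s (x, z)) := by fun_prop
  exact hc.integrable_of_hasCompactSupport (HasCompactSupport.of_compactSpace _)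

lemma continuous_markovOp (hs : Continuous s) {f : X → ℝ} (hf : Continuous f) :
    Continuous (markovOp s m f) := by
  have h : Continuous (fun x z => f (s (x, z))).uncurry := by
    exact hf.comp hs
  have := continuous_parametric_integral_of_continuous (μ := m) h isCompact_univ
  rw [Measure.restrict_univ] at this
  exact this

lemma continuous_iterate_markovOp (hs : Continuous s) (n : ℕ) {f : X → ℝ} (hf : Continuous f) :
    Continuous ((markovOp s m)^[n] f) := by
  induction n generalizing f with
  | zero => simpa using hf
  | succ n ih => exact ih (continuous_markovOp hs hf)

/-- Positivity of the operator. With `α = 1` and `α = -1` the same form carries upper and lower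
bounds through the iterates. -/
lemma markovOp_affine_le (hs : Continuous s) {f g : X → ℝ} (hf : Continuous f) (hg : Continuous g)
    {c α β : ℝ} (h : ∀ x, α * f x ≤ c + β * g x) (x : X) :
    α * markovOp s m f x ≤ c + β * markovOp s m g x := by
  have hF := integrable_comp_randomMap (m := m) hs hf x
  have hG := integrable_comp_randomMap (m := m) hs hg x
  have := integral_mono (hF.const_mul α) ((integrable_const c).add (hG.const_mul β))
    (fun z => h (s (x, z)))
  simp only [Pi.add_apply] at this
  rw [integral_add (integrable_const c) (hG.const_mul β), integral_const_mul,
    integral_const_mul] at this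
  simpa [markovOp] using this

lemma iterate_markovOp_affine_le (hs : Continuous s) (n : ℕ) {f g : X → ℝ} (hf : Continuous f)
    (hg : Continuous g) {c α β : ℝ} (h : ∀ x, α * f x ≤ c + β * g x) (x : X) :
    α * (markovOp s m)^[n] f x ≤ c + β * (markovOp s m)^[n] g x := by
  induction n generalizing f g with
  | zero => simpa using h x
  | succ n ih =>
    exact ih (continuous_markovOp hs hf) (continuous_markovOp hs hg) (markovOp_affine_le hs hf hg h)

/-- Positivity at one value of the noise persists on an open set, which is charged by `m`. Iterating
turns a single controlled orbit into a positive probability. -/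
lemma markovOp_pos [m.IsOpenPosMeasure] (hs : Continuous s) {g : X → ℝ} (hg : Continuous g)
    (h0 : ∀ x, 0 ≤ g x) {x : X} {z : Z} (hz : 0 < g (s (x, z))) : 0 < markovOp s m g x := by
  have hc : Continuous fun z => g (s (x, z)) := by fun_prop
  exact hc.integral_pos_of_hasCompactSupport_nonneg_nonzero (HasCompactSupport.of_compactSpace _)
    (fun z => h0 _) hz.ne'

lemma iterate_markovOp_pos [m.IsOpenPosMeasure] (hs : Continuous s) (n : ℕ) {g : X → ℝ}
    (hg : Continuous g) (h0 : ∀ x, 0 ≤ g x) {x : X} {ζ : ℕ → Z} (hz : 0 < g (orbit s x ζ n)) :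
    0 < (markovOp s m)^[n] g x := by
  induction n generalizing g with
  | zero => simpa [orbit] using hz
  | succ n ih =>
    exact ih (continuous_markovOp hs hg) (fun x => integral_nonneg fun z => h0 _)
      (markovOp_pos hs hg h0 hz)

lemma isProbabilityMeasure_markovPush (hs : Continuous s) (ν : Measure X) [IsProbabilityMeasure ν] :
    IsProbabilityMeasure (markovPush s m ν) := by
  have : SecondCountableTopology X := EMetric.secondCountable_of_sigmaCompact X
  exact Measure.isProbabilityMeasure_map hs.measurable.aemeasurable

lemma isProbabilityMeasure_iterate_markovPush (hs : Continuous s) (k : ℕ) (ν : Measure X)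
    [IsProbabilityMeasure ν] : IsProbabilityMeasure ((markovPush s m)^[k] ν) := by
  induction k with
  | zero => simpa
  | succ k ih =>
    rw [Function.iterate_succ_apply']
    exact isProbabilityMeasure_markovPush hs _

lemma integrable_of_continuous {f : X → ℝ} (hf : Continuous f) (ν : Measure X)
    [IsFiniteMeasure ν] : Integrable f ν :=
  hf.integrable_of_hasCompactSupport (HasCompactSupport.of_compactSpace _)

lemma integral_markovPush (hs : Continuous s) {f : X → ℝ} (hf : Continuous f) (ν : Measure X)
    [IsProbabilityMeasure ν] : ∫ x, f x ∂(markovPush s m ν) = ∫ x, markovOp s m f x ∂ν := by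
  have : SecondCountableTopology X := EMetric.secondCountable_of_sigmaCompact X
  rw [markovPush, integral_map hs.measurable.aemeasurable hf.measurable.aestronglyMeasurable,
    integral_prod]
  · rfl
  · exact (hf.comp hs).integrable_of_hasCompactSupport (HasCompactSupport.of_compactSpace _)

lemma integral_iterate_markovPush (hs : Continuous s) (k : ℕ) {f : X → ℝ} (hf : Continuous f)
    (ν : Measure X) [IsProbabilityMeasure ν] :
    ∫ x, f x ∂((markovPush s m)^[k] ν) = ∫ x, (markovOp s m)^[k] f x ∂ν := by
  induction k generalizing f with
  | zero => rfl
  | succ k ih =>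
    have := isProbabilityMeasure_iterate_markovPush (m := m) hs k ν
    rw [Function.iterate_succ_apply', integral_markovPush hs hf, ih (continuous_markovOp hs hf)]
    rfl

lemma TruncLip.abs_sub_integral_le {K : ℝ≥0} {a : ℝ} (ha : 0 ≤ a) {f : X → ℝ} (hf : TruncLip K a f)
    (ν μ : Measure X) [IsProbabilityMeasure ν] [IsProbabilityMeasure μ] :
    |(∫ x, f x ∂ν) - ∫ x, f x ∂μ| ≤ a := by
  have key : ∀ y, |(∫ x, f x ∂ν) - f y| ≤ a := by
    intro y
    have h1 : (∫ x, f x ∂ν) - f y = ∫ x, (f x - f y) ∂ν := by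
      rw [integral_sub (integrable_of_continuous hf.continuous ν) (integrable_const _)]
      simp
    rw [h1]
    have := norm_integral_le_of_norm_le_const (μ := ν) (f := fun x => f x - f y) (C := a)
      (Eventually.of_forall fun x => hf.abs_sub_le ha x y)
    simpa using this
  have h1 : (∫ x, f x ∂ν) - ∫ x, f x ∂μ = ∫ y, ((∫ x, f x ∂ν) - f y) ∂μ := by
    rw [integral_sub (integrable_const _) (integrable_of_continuous hf.continuous μ)]
    simp
  rw [h1]
  have := norm_integral_le_of_norm_le_const (μ := μ) (f := fun y => (∫ x, f x ∂ν) - f y) (C := a)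
    (Eventually.of_forall key)
  simpa using this

/-- Measures are determined by the integrals of functions that are Lipschitz for `truncDist`. -/
lemma measure_ext_of_truncLip {K : ℝ≥0} (hK : 0 < K) {ν μ : Measure X} [IsProbabilityMeasure ν]
    [IsProbabilityMeasure μ]
    (h : ∀ a f, 0 ≤ a → TruncLip K a f → ∫ x, f x ∂ν = ∫ x, f x ∂μ) : ν = μ := by
  refine ext_of_generate_finite _ (BorelSpace.measurable_eq.trans borel_eq_generateFrom_isClosed)
    isPiSystem_isClosed (fun F hF => ?_) (by simp)
  have hpos : ∀ n : ℕ, (0 : ℝ) < 1 / ((n : ℝ) + 1) := fun n => Nat.one_div_pos_of_nat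
  have h1 := tendsto_integral_thickenedIndicator_of_isClosed ν hF hpos
    tendsto_one_div_add_atTop_nhds_zero_nat
  have h2 := tendsto_integral_thickenedIndicator_of_isClosed μ hF hpos
    tendsto_one_div_add_atTop_nhds_zero_nat
  have h3 : ∀ n : ℕ, ∫ x, (thickenedIndicator (hpos n) F x : ℝ) ∂ν =
      ∫ x, (thickenedIndicator (hpos n) F x : ℝ) ∂μ := by
    intro n
    -- Thickened indicators have values in `[0, 1]` and Lipschitz constant `n + 1`. The entry `1`
    -- serves pairs with `d_K = 1`; for the others `d = d_K / K`.
    refine h (max 1 (((n : ℝ) + 1) / K)) _ (by positivity) (fun x y => ?_)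
    have hb : |(thickenedIndicator (hpos n) F x : ℝ) - thickenedIndicator (hpos n) F y| ≤ 1 := by
      have hx := thickenedIndicator_le_one (hpos n) F x
      have hy := thickenedIndicator_le_one (hpos n) F y
      have hx' : (thickenedIndicator (hpos n) F x : ℝ) ≤ 1 := by exact_mod_cast hx
      have hy' : (thickenedIndicator (hpos n) F y : ℝ) ≤ 1 := by exact_mod_cast hy
      have := (thickenedIndicator (hpos n) F x).coe_nonneg
      have := (thickenedIndicator (hpos n) F y).coe_nonneg
      rw [abs_le]; constructor <;> linarith
    rcases le_or_gt 1 ((K : ℝ≥0∞) * edist x y) with hxy | hxy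
    · rw [truncDist_of_one_le hxy, mul_one]
      exact hb.trans (le_max_left _ _)
    · rw [truncDist_of_lt_one hxy]
      have hl := lipschitzWith_thickenedIndicator (hpos n) F x y
      have hne : edist x y ≠ ⊤ := by
        intro hT
        rw [hT, ENNReal.mul_top (by simpa using hK.ne')] at hxy
        simp at hxy
      have hl' := ENNReal.toReal_mono (ENNReal.mul_ne_top ENNReal.coe_ne_top hne) hl
      rw [edist_dist, ENNReal.toReal_ofReal dist_nonneg, NNReal.dist_eq, ENNReal.toReal_mul] at hl'
      refine hl'.trans ?_
      rw [← mul_assoc]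
      gcongr
      have hK' : (0 : ℝ) < K := by exact_mod_cast hK
      calc _ = ((n : ℝ) + 1) / K * K := by
            rw [div_mul_cancel₀ _ hK'.ne']
            rw [ENNReal.coe_toReal, NNReal.coe_inv, Real.coe_toNNReal _ (hpos n).le, one_div, inv_inv]
        _ ≤ _ := by gcongr; exact le_max_right _ _
  have h4 := tendsto_nhds_unique (h1.congr h3) h2
  exact (measureReal_eq_measureReal_iff).1 h4


/-- Exponentially decaying bounds tend to zero. -/
lemma tendsto_mul_exp_neg_mul {γ : ℝ} (hγ : 0 < γ) (C a : ℝ) :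
    Tendsto (fun k : ℕ => C * Real.exp (-γ * k) * a) atTop (𝓝 0) := by
  have : Tendsto (fun k : ℕ => Real.exp (-γ * k)) atTop (𝓝 0) :=
    Real.tendsto_exp_atBot.comp
      (tendsto_natCast_atTop_atTop.const_mul_atTop_of_neg (by linarith))
  simpa using (this.const_mul C).mul_const a

/-! ### Contraction of the truncated distance, and exponential mixing -/

section Contraction

variable {K : ℝ≥0}

/-- For pairs at truncated distance `1` it is enough that `f` oscillates by at most `a`. -/
lemma TruncLip.markovOp_of_local {f : X → ℝ} {a : ℝ} (ha : 0 ≤ a) (hs : Continuous s)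
    (hf : TruncLip K a f)
    (hloc : ∀ x y, truncDist K x y < 1 →
      |markovOp s m f x - markovOp s m f y| ≤ 3 / 4 * a * truncDist K x y) :
    TruncLip K a (markovOp s m f) := by
  intro x y
  rcases (truncDist_le_one (K := K) x y).lt_or_eq with h | h
  · refine (hloc x y h).trans ?_
    have := mul_nonneg ha (truncDist_nonneg (K := K) x y)
    nlinarith
  · rw [h, mul_one]
    have h1 : markovOp s m f x - markovOp s m f y = ∫ z, (f (s (x, z)) - f (s (y, z))) ∂m := by
      rw [integral_sub (integrable_comp_randomMap hs hf.continuous x)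
        (integrable_comp_randomMap hs hf.continuous y)]
      rfl
    rw [h1]
    have := norm_integral_le_of_norm_le_const (μ := m) (f := fun z => f (s (x, z)) - f (s (y, z)))
      (C := a) (Eventually.of_forall fun z => hf.abs_sub_le ha _ _)
    simpa using this

variable (hs : Continuous s)
  (hloc : ∀ (a : ℝ) (f : X → ℝ), 0 ≤ a → TruncLip K a f → ∀ x y, truncDist K x y < 1 →
    |markovOp s m f x - markovOp s m f y| ≤ 3 / 4 * a * truncDist K x y)

include hs hloc in
lemma TruncLip.iterate_markovOp (n : ℕ) {f : X → ℝ} {a : ℝ} (ha : 0 ≤ a) (hf : TruncLip K a f) :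
    TruncLip K a ((markovOp s m)^[n] f) := by
  induction n generalizing f with
  | zero => exact hf
  | succ n ih => exact ih (hf.markovOp_of_local ha hs (hloc a f ha hf))

include hs in
/-- If all points reach a neighbourhood of `c` at time `n`, then the oscillation of functions that
vary little on this neighbourhood decreases by a fixed factor in time `n`. -/
lemma exists_oscillation_bound [m.IsOpenPosMeasure] {n : ℕ} {c : X}
    (hreach : ∀ x, ∃ ζ, truncDist K (orbit s x ζ n) c < 1 / 4) :
    ∃ p : ℝ, 0 < p ∧ p ≤ 1 ∧ ∀ (a : ℝ) (f : X → ℝ), 0 ≤ a → TruncLip K a f → ∀ x y,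
      (markovOp s m)^[n] f x - (markovOp s m)^[n] f y ≤ (1 - p / 2) * a := by
  -- A bump living where `d_K(z, c) < 1/4`, so that `f` is within `a / 4` of `f c` wherever `g > 0`.
  set g : X → ℝ := fun z => max 0 (1 - 4 * truncDist K z c) with hg
  have hgc : Continuous g :=
    continuous_const.max (continuous_const.sub ((continuous_truncDist c).const_mul 4))
  have hg0 : ∀ z, 0 ≤ g z := fun z => le_max_left _ _
  have hg1 : ∀ z, g z ≤ 1 := fun z => max_le zero_le_one (by linarith [truncDist_nonneg (K := K) z c])
  have hGpos : ∀ x, 0 < (markovOp s m)^[n] g x := by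
    intro x
    obtain ⟨ζ, hζ⟩ := hreach x
    exact iterate_markovOp_pos hs n hgc hg0 (lt_max_of_lt_right (by linarith))
  have hGc := continuous_iterate_markovOp (m := m) hs n hgc
  obtain ⟨x₀, -, hx₀⟩ := isCompact_univ.exists_isMinOn ⟨c, mem_univ c⟩ hGc.continuousOn
  set p := (markovOp s m)^[n] g x₀
  have hp : ∀ x, p ≤ (markovOp s m)^[n] g x := fun x => hx₀ (mem_univ x)
  have hp1 : p ≤ 1 := by
    have := iterate_markovOp_affine_le (m := m) hs n hgc hgc (α := 1) (c := 1) (β := 0)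
      (by simpa using hg1) x₀
    simpa using this
  refine ⟨p, hGpos x₀, hp1, fun a f ha hf x y => ?_⟩
  obtain ⟨xm, -, hxm⟩ := isCompact_univ.exists_isMinOn ⟨c, mem_univ c⟩ hf.continuous.continuousOn
  obtain ⟨xM, -, hxM⟩ := isCompact_univ.exists_isMaxOn ⟨c, mem_univ c⟩ hf.continuous.continuousOn
  replace hxm : ∀ z, f xm ≤ f z := fun z => hxm (mem_univ z)
  replace hxM : ∀ z, f z ≤ f xM := fun z => hxM (mem_univ z)
  have hosc : f xM - f xm ≤ a := (le_abs_self _).trans (hf.abs_sub_le ha _ _)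
  have hnear : ∀ z, 0 < g z → |f z - f c| ≤ a / 4 := by
    intro z hz
    refine (hf z c).trans ?_
    have h1 : 0 < 1 - 4 * truncDist K z c := by
      rcases lt_max_iff.1 hz with h | h
      · exact absurd h (lt_irrefl _)
      · exact h
    nlinarith
  -- The right-hand side is the barycentre of `b` and `v` with weight `g` on `v`: the better bound
  -- `v` is used only where the bump is positive.
  have hbary : ∀ {u v b g : ℝ}, 0 ≤ g → g ≤ 1 → u ≤ b → (0 < g → u ≤ v) →
      u ≤ b - (b - v) * g := by
    intro u v b g h0 h1 hb hv
    rcases h0.eq_or_lt with h | h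
    · rw [← h]; linarith
    · nlinarith [hv h]
  set t := min (f xM) (f c + a / 4)
  set r := max (f xm) (f c - a / 4)
  have hup := iterate_markovOp_affine_le (m := m) hs n hf.continuous hgc (α := 1) (c := f xM)
    (β := -(f xM - t)) (fun z => by
      have := hbary (v := t) (hg0 z) (hg1 z) (hxM z) (fun h => le_min (hxM z) (by
        linarith [(abs_le.1 (hnear z h)).2]))
      linarith) x
  have hlo := iterate_markovOp_affine_le (m := m) hs n hf.continuous hgc (α := -1) (c := -f xm)
    (β := -(r - f xm)) (fun z => by
      have := hbary (u := -f z) (v := -r) (hg0 z) (hg1 z) (neg_le_neg (hxm z))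
        (fun h => neg_le_neg (max_le (hxm z) (by linarith [(abs_le.1 (hnear z h)).1])))
      linarith) y
  have h1 := mul_le_mul_of_nonneg_left (hp x) (sub_nonneg.2 (min_le_left _ _) : 0 ≤ f xM - t)
  have h2 := mul_le_mul_of_nonneg_left (hp y) (sub_nonneg.2 (le_max_left _ _) : 0 ≤ r - f xm)
  -- The two bounds differ by at most `(1 - p) (f xM - f xm) + p (t - r)`, whence `(1 - p) a + p a /
  -- 2`.
  have h3 : t - r ≤ a / 2 := by
    have := min_le_right (f xM) (f c + a / 4)
    have := le_max_right (f xm) (f c - a / 4)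
    linarith
  have hp0 := (hGpos x₀).le
  have h4 : (1 - p) * (f xM - f xm) ≤ (1 - p) * a := by
    gcongr
  nlinarith

include hs hloc in
lemma exists_truncLip_iterate_contraction [m.IsOpenPosMeasure] {n : ℕ} (hn : 1 ≤ n) {c : X}
    (hreach : ∀ x, ∃ ζ, truncDist K (orbit s x ζ n) c < 1 / 4) :
    ∃ α : ℝ, 0 < α ∧ α < 1 ∧ ∀ (a : ℝ) (f : X → ℝ), 0 ≤ a → TruncLip K a f →
      TruncLip K (α * a) ((markovOp s m)^[n] f) := by
  obtain ⟨p, hp0, hp1, hp⟩ := exists_oscillation_bound (m := m) hs hreach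
  refine ⟨max (3 / 4) (1 - p / 2), lt_max_of_lt_left (by norm_num),
    max_lt (by norm_num) (by linarith), fun a f ha hf x y => ?_⟩
  rcases (truncDist_le_one (K := K) x y).lt_or_eq with h | h
  -- Since `n ≥ 1`, there is a last application of the operator. It yields the factor `3/4`; the
  -- preceding ones preserve the class.
  · obtain ⟨k, rfl⟩ := Nat.exists_eq_add_of_le' hn
    rw [Function.iterate_succ_apply']
    refine (hloc a _ ha (hf.iterate_markovOp hs hloc k ha) x y h).trans ?_
    have := truncDist_nonneg (K := K) x y
    gcongr
    exact le_max_left _ _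
  · rw [h, mul_one, abs_le]
    have h1 := hp a f ha hf x y
    have h2 := hp a f ha hf y x
    have h3 : (1 - p / 2) * a ≤ max (3 / 4) (1 - p / 2) * a := by
      gcongr; exact le_max_right _ _
    constructor <;> linarith

include hs hloc in
lemma exists_truncLip_iterate_exp [m.IsOpenPosMeasure] {n : ℕ} (hn : 1 ≤ n) {c : X}
    (hreach : ∀ x, ∃ ζ, truncDist K (orbit s x ζ n) c < 1 / 4) :
    ∃ γ C : ℝ, 0 < γ ∧ 0 < C ∧ ∀ (a : ℝ) (f : X → ℝ), 0 ≤ a → TruncLip K a f → ∀ k : ℕ,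
      TruncLip K (C * Real.exp (-γ * k) * a) ((markovOp s m)^[k] f) := by
  obtain ⟨α, hα0, hα1, hα⟩ := exists_truncLip_iterate_contraction hs hloc hn hreach
  have hn' : (0 : ℝ) < n := by exact_mod_cast hn
  have hit : ∀ (j : ℕ) (a : ℝ) (f : X → ℝ), 0 ≤ a → TruncLip K a f →
      TruncLip K (α ^ j * a) ((markovOp s m)^[n * j] f) := by
    intro j
    induction j with
    | zero => intro a f ha hf; simpa using hf
    | succ j ih =>
      intro a f ha hf
      have := hα _ _ (by positivity) (ih a f ha hf)
      rw [← Function.iterate_add_apply] at this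
      convert this using 1
      · ring
      · congr 1; ring
  -- A factor `α` is gained every `n` steps; `α⁻¹` pays for the incomplete last block of length `k %
  -- n`.
  refine ⟨-Real.log α / n, α⁻¹, div_pos (neg_pos.2 (Real.log_neg hα0 hα1)) hn', inv_pos.2 hα0,
    fun a f ha hf k => ?_⟩
  have h1 := (hit (k / n) a f ha hf).iterate_markovOp hs hloc (k % n) (by positivity)
  rw [← Function.iterate_add_apply, Nat.mod_add_div] at h1
  refine h1.mono ?_
  gcongr
  have h2 : (k : ℝ) / n ≤ ((k / n : ℕ) : ℝ) + 1 := by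
    rw [div_le_iff₀ hn']
    have := Nat.lt_mul_div_succ k hn
    have h3 : (k : ℝ) ≤ n * ((k / n : ℕ) + 1) := by exact_mod_cast this.le
    linarith
  have h3 : α⁻¹ * Real.exp (-(-Real.log α / n) * k) = Real.exp (Real.log α * (k / n - 1)) := by
    rw [mul_sub, Real.exp_sub, mul_one, Real.exp_log hα0, inv_mul_eq_div,
      show -(-Real.log α / n) * k = Real.log α * (k / n) by ring]
  rw [h3, ← Real.exp_log (pow_pos hα0 _), Real.log_pow]
  refine Real.exp_le_exp.2 ?_
  have := Real.log_neg hα0 hα1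
  nlinarith

-- The iterates of a Dirac mass have a cluster point by compactness. One further step changes
-- integrals of `TruncLip` functions by a quantity tending to zero, so the cluster point is
-- stationary, without averaging in time.
include hs hloc in
lemma exists_stationary [m.IsOpenPosMeasure] (hK : 0 < K) {n : ℕ} (hn : 1 ≤ n) {c : X}
    (hreach : ∀ x, ∃ ζ, truncDist K (orbit s x ζ n) c < 1 / 4) :
    ∃ μ : Measure X, IsProbabilityMeasure μ ∧ markovPush s m μ = μ := by
  obtain ⟨γ, C, hγ, hC, hexp⟩ := exists_truncLip_iterate_exp hs hloc hn hreach
  have hprob := fun k => isProbabilityMeasure_iterate_markovPush (m := m) hs k (Measure.dirac c)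
  let M : ℕ → ProbabilityMeasure X := fun k => ⟨(markovPush s m)^[k] (Measure.dirac c), hprob k⟩
  obtain ⟨μ, hμ⟩ := exists_clusterPt_of_compactSpace (map M atTop)
  refine ⟨μ, inferInstance, ?_⟩
  have := isProbabilityMeasure_markovPush (m := m) hs (μ : Measure X)
  refine measure_ext_of_truncLip hK fun a f ha hf => ?_
  rw [integral_markovPush hs hf.continuous]
  have hPf := hf.markovOp_of_local ha hs (hloc a f ha hf)
  have hdiff : Tendsto (fun k : ℕ => (markovOp s m)^[k] (markovOp s m f) c - (markovOp s m)^[k] f c)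
      atTop (𝓝 0) := by
    refine squeeze_zero_norm (fun k => ?_) (tendsto_mul_exp_neg_mul hγ C a)
    have hk := hexp a f ha hf k
    have := isProbabilityMeasure_markovPush (m := m) hs (Measure.dirac c)
    have := hk.abs_sub_integral_le (by positivity) (markovPush s m (Measure.dirac c))
      (Measure.dirac c)
    rw [integral_markovPush hs hk.continuous, integral_dirac, integral_dirac,
      ← Function.iterate_succ_apply' (markovOp s m), Function.iterate_succ_apply] at this
    exact this
  have hcont : ∀ g : X → ℝ, Continuous g →
      Continuous fun ν : ProbabilityMeasure X => ∫ x, g x ∂(ν : Measure X) := fun g hg =>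
    ProbabilityMeasure.continuous_integral_boundedContinuousFunction
      (BoundedContinuousFunction.mkOfCompact ⟨g, hg⟩)
  have h1 : MapClusterPt μ atTop M := hμ
  have h2 := h1.continuousAt_comp ((hcont _ hPf.continuous).sub (hcont f hf.continuous)).continuousAt
  have h3 : MapClusterPt ((∫ x, markovOp s m f x ∂(μ : Measure X)) - ∫ x, f x ∂(μ : Measure X))
      atTop fun k : ℕ => (markovOp s m)^[k] (markovOp s m f) c - (markovOp s m)^[k] f c := by
    convert! h2 using 1
    ext k
    change _ = (∫ x, markovOp s m f x ∂((markovPush s m)^[k] (Measure.dirac c))) -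
      ∫ x, f x ∂((markovPush s m)^[k] (Measure.dirac c))
    rw [integral_iterate_markovPush hs k hf.continuous,
      integral_iterate_markovPush hs k hPf.continuous, integral_dirac, integral_dirac]
  have h4 : NeBot (𝓝 ((∫ x, markovOp s m f x ∂(μ : Measure X)) - ∫ x, f x ∂(μ : Measure X)) ⊓
      𝓝 (0 : ℝ)) := NeBot.mono h3 (inf_le_inf_left _ hdiff)
  exact sub_eq_zero.1 (eq_of_nhds_neBot h4)

include hs hloc in
/-- Uniqueness and exponential mixing for a random map whose Markov operator contracts the
truncated distance locally and which reaches a neighbourhood of some point from everywhere. -/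
theorem exists_exponentialMixing [m.IsOpenPosMeasure] (hK : 0 < K) {n : ℕ} (hn : 1 ≤ n) {c : X}
    (hreach : ∀ x, ∃ ζ, truncDist K (orbit s x ζ n) c < 1 / 4) :
    ∃ μ : Measure X, (IsProbabilityMeasure μ ∧ markovPush s m μ = μ) ∧
      ∃ γ C : ℝ, 0 < γ ∧ 0 < C ∧ ∀ ν : Measure X, IsProbabilityMeasure ν → ∀ (a : ℝ) (f : X → ℝ),
        0 ≤ a → TruncLip K a f → ∀ k : ℕ,
          |(∫ x, f x ∂((markovPush s m)^[k] ν)) - ∫ x, f x ∂μ| ≤ C * Real.exp (-γ * k) * a := by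
  obtain ⟨μ, hμp, hμ⟩ := exists_stationary hs hloc hK hn hreach
  obtain ⟨γ, C, hγ, hC, hexp⟩ := exists_truncLip_iterate_exp hs hloc hn hreach
  refine ⟨μ, ⟨hμp, hμ⟩, γ, C, hγ, hC, fun ν hν a f ha hf k => ?_⟩
  have h1 : ∫ x, f x ∂μ = ∫ x, (markovOp s m)^[k] f x ∂μ := by
    rw [← integral_iterate_markovPush hs k hf.continuous, Function.iterate_fixed hμ]
  rw [h1, integral_iterate_markovPush hs k hf.continuous]
  exact (hexp a f ha hf k).abs_sub_integral_le (by positivity) _ _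

end Contraction

end RandomMap

/-! ### Total variation cost of finite-dimensional shifts of the noise -/

section Shift

/-- The integrand is at most `L ‖θ‖` and vanishes off `K` and its translate by `θ`, which have equal
measure. -/
lemma integral_abs_sub_translate_le {V : Type*} [NormedAddCommGroup V] [MeasurableSpace V]
    [BorelSpace V] {m : Measure V} [m.IsAddHaarMeasure] {K : Set V} (hK : IsCompact K)
    {φ : V → ℝ} {L : ℝ} (hL : ∀ v v', |φ v - φ v'| ≤ L * ‖v - v'‖) (hφ : ∀ v, v ∉ K → φ v = 0)
    (θ : V) : ∫ v, |φ (v - θ) - φ v| ∂m ≤ 2 * L * m.real K * ‖θ‖ := by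
  have hKm := hK.measurableSet
  have hKi : Integrable (K.indicator fun _ => L * ‖θ‖) m :=
    (integrable_indicator_iff hKm).2 (integrableOn_const hK.measure_ne_top)
  have hKi' : Integrable (fun v => K.indicator (fun _ => L * ‖θ‖) (v - θ)) m :=
    hKi.comp_sub_right θ
  have hint : ∫ v, K.indicator (fun _ => L * ‖θ‖) v ∂m = m.real K * (L * ‖θ‖) := by
    rw [integral_indicator_const _ hKm, smul_eq_mul]
  have hb : ∀ v, |φ (v - θ) - φ v| ≤ L * ‖θ‖ := fun v => by
    simpa using hL (v - θ) v
  have h0 : ∀ v, 0 ≤ K.indicator (fun _ => L * ‖θ‖) v := fun v =>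
    indicator_nonneg (fun v _ => (abs_nonneg _).trans (hb v)) v
  calc ∫ v, |φ (v - θ) - φ v| ∂m
      ≤ ∫ v, (K.indicator (fun _ => L * ‖θ‖) (v - θ) + K.indicator (fun _ => L * ‖θ‖) v) ∂m := by
        refine integral_mono_of_nonneg (Eventually.of_forall fun v => abs_nonneg _)
          (hKi'.add hKi) (Eventually.of_forall fun v => ?_)
        by_cases h1 : v - θ ∈ K
        · have := h0 v
          simp only [indicator_of_mem h1]
          linarith [hb v]
        · by_cases h2 : v ∈ K
          · have := h0 (v - θ)
            simp only [indicator_of_mem h2]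
            linarith [hb v]
          · simp [hφ _ h1, hφ _ h2, h1, h2]
    _ = 2 * L * m.real K * ‖θ‖ := by
        rw [integral_add hKi' hKi, integral_sub_right_eq_self, hint]
        ring

/-- The part of `{ρ ≠ 0}` outside `K` is open and null, hence empty. -/
lemma eq_zero_of_withDensity_compl_eq_zero {V : Type*} [TopologicalSpace V] [MeasurableSpace V]
    [BorelSpace V] {m : Measure V} [m.IsOpenPosMeasure] {K : Set V} (hK : IsClosed K) {ρ : V → ℝ}
    (hρ : Continuous ρ) (hρ0 : ∀ v, 0 ≤ ρ v)
    (h : m.withDensity (fun v => ENNReal.ofReal (ρ v)) Kᶜ = 0) (v : V) (hv : v ∉ K) : ρ v = 0 := by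
  rw [withDensity_apply_eq_zero (by fun_prop)] at h
  have hopen : IsOpen ({v | ENNReal.ofReal (ρ v) ≠ 0} ∩ Kᶜ) := by
    refine IsOpen.inter ?_ hK.isOpen_compl
    exact isOpen_ne_fun (ENNReal.continuous_ofReal.comp hρ) continuous_const
  have := (hopen.measure_eq_zero_iff m).1 h
  by_contra hne
  have hm : v ∈ ({v | ENNReal.ofReal (ρ v) ≠ 0} ∩ Kᶜ) :=
    ⟨by simpa using lt_of_le_of_ne (hρ0 v) (Ne.symm hne), hv⟩
  rw [this] at hm
  exact hm

/-- If the projection of `ℓ` to a finite-dimensional space `F` is independent of the complementary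
projection and has a `C¹` density, then translations along `F` change the measures `χ ℓ`, with
`χ` Lipschitz, by a small amount in total variation. -/
theorem exists_translation_bound {E : Type*} [NormedAddCommGroup E] [NormedSpace ℝ E]
    [MeasurableSpace E] [BorelSpace E] [SecondCountableTopology E] {ℓ : Measure E}
    [IsProbabilityMeasure ℓ] {K : Set E} (hK : IsCompact K) (hKℓ : ℓ Kᶜ = 0)
    {F G : Submodule ℝ E} [FiniteDimensional ℝ F] (h : IsCompl F G)
    (hP : Continuous (F.projectionOnto G h)) (hQ : Continuous (G.projectionOnto F h.symm))
    (hprod : ℓ.map (fun v => (F.projectionOnto G h v, G.projectionOnto F h.symm v)) =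
      (ℓ.map (F.projectionOnto G h)).prod (ℓ.map (G.projectionOnto F h.symm)))
    {m : Measure F} [m.IsAddHaarMeasure] {ρ : F → ℝ} (hρ : ContDiff ℝ 1 ρ) (hρ0 : ∀ v, 0 ≤ ρ v)
    (hdens : ℓ.map (F.projectionOnto G h) = m.withDensity fun v => ENNReal.ofReal (ρ v))
    {χ : E → ℝ} {L : ℝ≥0} (hχ : LipschitzWith L χ) (hχ1 : ∀ v, |χ v| ≤ 1) :
    ∃ C : ℝ, 0 ≤ C ∧ ∀ (θ : F) (g : E → ℝ) (b : ℝ), Measurable g → (∀ v, |g v| ≤ b) →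
      |(∫ η, g (η + θ) * χ η ∂ℓ) - ∫ η, g η * χ η ∂ℓ| ≤ C * b * ‖θ‖ := by
  set P := F.projectionOnto G h with hPdef
  set Q := G.projectionOnto F h.symm with hQdef
  have hPp : IsProbabilityMeasure (ℓ.map P) :=
    Measure.isProbabilityMeasure_map hP.measurable.aemeasurable
  have hQp : IsProbabilityMeasure (ℓ.map Q) :=
    Measure.isProbabilityMeasure_map hQ.measurable.aemeasurable
  have hPK : IsCompact (P '' K) := hK.image hP
  have hsupp : ∀ v, v ∉ P '' K → ρ v = 0 := by
    refine eq_zero_of_withDensity_compl_eq_zero (m := m) hPK.isClosed hρ.continuous hρ0 ?_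
    rw [← hdens, Measure.map_apply hP.measurable hPK.isClosed.measurableSet.compl]
    refine measure_mono_null (fun x hx hxK => hx ⟨x, hxK, rfl⟩) hKℓ
  have hcs : HasCompactSupport ρ := HasCompactSupport.intro hPK (fun v hv => hsupp v hv)
  obtain ⟨Lρ, hLρ⟩ := hρ.lipschitzWith_of_hasCompactSupport hcs one_ne_zero
  obtain ⟨M, hM⟩ := hρ.continuous.bounded_above_of_compact_support hcs
  have hM0 : 0 ≤ M := (norm_nonneg _).trans (hM 0)
  refine ⟨2 * (Lρ + M * L) * m.real (P '' K), by positivity, fun θ g b hg hgb => ?_⟩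
  have hadd : ∀ v, ((P v : E) + Q v) = v := fun v =>
    by
    simpa [P, Q] using Submodule.projection_add_projection_eq_self h v
  -- Independence lets integrals be computed fibre by fibre along `F`; no regularity in the
  -- direction `G` is needed.
  have hℓ : ((ℓ.map P).prod (ℓ.map Q)).map (fun p : F × G => (p.1 : E) + p.2) = ℓ := by
    rw [← hprod, Measure.map_map (by fun_prop) (hP.measurable.prodMk hQ.measurable)]
    simp [Function.comp_def, hadd]
  have hHi : ∀ (H : E → ℝ) (B : ℝ), Measurable H → (∀ v, |H v| ≤ B) →
      Integrable (fun p : F × G => H (p.1 + p.2)) ((ℓ.map P).prod (ℓ.map Q)) := by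
    intro H B hH hB
    exact Integrable.of_bound (hH.comp (by fun_prop)).aestronglyMeasurable B (Eventually.of_forall fun p => hB _)
  have hrep : ∀ (H : E → ℝ) (B : ℝ), Measurable H → (∀ v, |H v| ≤ B) →
      ∫ η, H η ∂ℓ = ∫ w, ∫ v, H ((v : E) + w) ∂(ℓ.map P) ∂(ℓ.map Q) := by
    intro H B hH hB
    conv_lhs => rw [← hℓ]
    rw [integral_map (by fun_prop) hH.aestronglyMeasurable, integral_prod_symm _ (hHi H B hH hB)]
  have hin : ∀ H : F → ℝ, ∫ v, H v ∂(ℓ.map P) = ∫ v, ρ v * H v ∂m := by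
    intro H
    rw [hdens, integral_withDensity_eq_integral_toReal_smul
      hρ.continuous.measurable.ennreal_ofReal (by simp)]
    simp [ENNReal.toReal_ofReal (hρ0 _)]
  have hb0 : 0 ≤ b := (abs_nonneg _).trans (hgb 0)
  have hχm : Measurable χ := hχ.continuous.measurable
  have hgχ : ∀ u v, |g u * χ v| ≤ b := fun u v => by
    rw [abs_mul]
    exact (mul_le_mul (hgb _) (hχ1 _) (abs_nonneg _) hb0).trans (mul_one b).le
  have hm1 : Measurable fun η => g (η + θ) * χ η := by fun_prop
  have hm2 : Measurable fun η => g η * χ η := by fun_prop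
  rw [hrep _ b hm1 (fun v => hgχ _ _), hrep _ b hm2 (fun v => hgχ _ _),
    ← integral_sub (hHi _ b hm1 (fun v => hgχ _ _)).integral_prod_right
      (hHi _ b hm2 (fun v => hgχ _ _)).integral_prod_right, ← Real.norm_eq_abs]
  have key : ∀ w : G, ‖(∫ v : F, g ((v : E) + w + θ) * χ ((v : E) + w) ∂(ℓ.map P)) -
      ∫ v : F, g ((v : E) + w) * χ ((v : E) + w) ∂(ℓ.map P)‖ ≤
      2 * (Lρ + M * L) * m.real (P '' K) * b * ‖θ‖ := by
    intro w
    -- The cut-off is absorbed into the density. A change of variables then moves the shift from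
    -- `g`, merely bounded, to `φ`, whose Lipschitz constant does not depend on `w`.
    set φ : F → ℝ := fun v => ρ v * χ ((v : E) + w) with hφ
    have hφL : ∀ v v', |φ v - φ v'| ≤ (Lρ + M * L) * ‖v - v'‖ := by
      intro v v'
      have h1 : φ v - φ v' = (ρ v - ρ v') * χ ((v : E) + w) +
          ρ v' * (χ ((v : E) + w) - χ ((v' : E) + w)) := by simp only [hφ]; ring
      rw [h1]
      refine (abs_add_le _ _).trans ?_
      rw [abs_mul, abs_mul, add_mul, mul_assoc]
      have h2 := hLρ.dist_le_mul v v'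
      have h3 := hχ.dist_le_mul ((v : E) + w) ((v' : E) + w)
      rw [Real.dist_eq, dist_eq_norm] at h2 h3
      rw [add_sub_add_right_eq_sub] at h3
      have h4 : ‖(v : E) - v'‖ = ‖v - v'‖ := rfl
      rw [h4] at h3
      refine add_le_add ?_ (mul_le_mul (hM v') h3 (abs_nonneg _) hM0)
      exact (mul_le_mul h2 (hχ1 _) (abs_nonneg _) (by positivity)).trans (mul_one _).le
    have hφ0 : ∀ v, v ∉ P '' K → φ v = 0 := fun v hv => by simp [hφ, hsupp v hv]
    have hφc : Continuous φ := by
      have := hχ.continuous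
      have := hρ.continuous
      fun_prop
    have hφi : Integrable φ m := hφc.integrable_of_hasCompactSupport
      (HasCompactSupport.intro hPK fun v hv => hφ0 v hv)
    have hgm : AEStronglyMeasurable (fun v : F => g ((v : E) + w)) m :=
      Measurable.aestronglyMeasurable (by fun_prop)
    rw [hin, hin]
    have h1 : ∫ v : F, ρ v * (g ((v : E) + w + θ) * χ ((v : E) + w)) ∂m =
        ∫ v : F, φ (v - θ) * g ((v : E) + w) ∂m := by
      rw [← integral_sub_right_eq_self _ θ]
      refine integral_congr_ae (Eventually.of_forall fun v => ?_)
      have : ((v - θ : F) : E) + w + θ = v + w := by push_cast; abel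
      simp only [hφ, this]
      ring
    have h2 : ∫ v : F, ρ v * (g ((v : E) + w) * χ ((v : E) + w)) ∂m =
        ∫ v : F, φ v * g ((v : E) + w) ∂m :=
      integral_congr_ae (Eventually.of_forall fun v => by simp only [hφ]; ring)
    have hbg : ∀ᵐ v : F ∂m, ‖g ((v : E) + w)‖ ≤ b := Eventually.of_forall fun v => hgb _
    rw [h1, h2, ← integral_sub ((hφi.comp_sub_right θ).mul_bdd hgm hbg) (hφi.mul_bdd hgm hbg)]
    calc _ ≤ ∫ v, |φ (v - θ) - φ v| * b ∂m := by
          refine norm_integral_le_of_norm_le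
            (((hφi.comp_sub_right θ).sub hφi).abs.mul_const b) (Eventually.of_forall fun v => ?_)
          rw [← sub_mul, norm_mul]
          exact mul_le_mul_of_nonneg_left (hgb _) (norm_nonneg _)
      _ = (∫ v, |φ (v - θ) - φ v| ∂m) * b := integral_mul_const _ _
      _ ≤ (2 * (Lρ + M * L) * m.real (P '' K) * ‖θ‖) * b := by
          gcongr
          exact integral_abs_sub_translate_le hPK hφL hφ0 θ
      _ = _ := by ring
  have := norm_integral_le_of_norm_le_const (μ := ℓ.map Q) (Eventually.of_forall key)
  simpa using this

end Shift

/-! ### Local comparison of the Riemannian distance with chart distances -/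

section RiemannianChart

variable {E : Type*} [NormedAddCommGroup E] [NormedSpace ℝ E] {H : Type*} [TopologicalSpace H]
  (I : ModelWithCorners ℝ E H) {M : Type*} [EMetricSpace M] [ChartedSpace H M]
  [RiemannianBundle (fun y : M => TangentSpace I y)] [IsManifold I 1 M]
  [IsContinuousRiemannianBundle E (fun y : M => TangentSpace I y)] [IsRiemannianManifold I M]

attribute [local instance] normedAddCommGroupTangentSpaceVectorSpace
attribute [local instance] normedSpaceTangentSpaceVectorSpace

lemma enorm_apply_le_of_opENorm_lt {V W : Type*} [SeminormedAddCommGroup V] [NormedSpace ℝ V]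
    [SeminormedAddCommGroup W] [NormedSpace ℝ W] {f : V →L[ℝ] W} {C : ℝ≥0} (h : ‖f‖ₑ < C) (v : V) :
    ‖f v‖ₑ ≤ C * ‖v‖ₑ :=
  (f.le_opENorm v).trans (mul_le_mul_left h.le _)

lemma eventually_enorm_mfderivWithin_symm_extChartAt_apply_le (x : M) :
    ∃ C > (0 : ℝ≥0), ∀ᶠ y in 𝓝[range I] (extChartAt I x x), ∀ v : E,
      ‖mfderiv[range I] (extChartAt I x).symm y v‖ₑ ≤ C * ‖v‖ₑ := by
  obtain ⟨C, hC0, hC⟩ := eventually_enorm_mfderivWithin_symm_extChartAt_lt I x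
  refine ⟨C, hC0, hC.mono fun y hy v => ?_⟩
  exact @enorm_apply_le_of_opENorm_lt _ _ _ _ _ _ _ _ hy v

lemma eventually_enorm_mfderiv_extChartAt_apply_le (x : M) :
    ∃ C > (0 : ℝ≥0), ∀ᶠ y in 𝓝 x, ∀ v : TangentSpace I y,
      ‖(mfderiv% (extChartAt I x) y v : E)‖ₑ ≤ C * ‖v‖ₑ := by
  obtain ⟨C, hC0, hC⟩ := eventually_enorm_mfderiv_extChartAt_lt I x
  refine ⟨C, hC0, hC.mono fun y hy v => ?_⟩
  exact @enorm_apply_le_of_opENorm_lt _ _ _ _ _ _ _ _ hy v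

/-- Around any point, the Riemannian distance is controlled by the distance in the chart. -/
lemma exists_nhds_edist_le_edist_extChartAt (x : M) :
    ∃ C > (0 : ℝ≥0), ∃ V ∈ 𝓝 x, ∀ p ∈ V, ∀ q ∈ V,
      edist p q ≤ C * edist (extChartAt I x p) (extChartAt I x q) := by
  rcases eventually_enorm_mfderivWithin_symm_extChartAt_apply_le I x with ⟨C, C_pos, hC⟩
  refine ⟨C, C_pos, ?_⟩
  obtain ⟨r, r_pos, hr⟩ : ∃ r > 0,
      Metric.ball (extChartAt I x x) r ∩ range I ⊆ (extChartAt I x).target ∩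
        {y | ∀ v : E, ‖mfderiv[range I] (extChartAt I x).symm y v‖ₑ ≤ C * ‖v‖ₑ} :=
    Metric.mem_nhdsWithin_iff.1 (inter_mem (extChartAt_target_mem_nhdsWithin x) hC)
  have A : (extChartAt I x) ⁻¹' (Metric.ball (extChartAt I x x) r ∩ range I) ∈ 𝓝 x := by
    apply extChartAt_preimage_mem_nhds_of_mem_nhdsWithin (by simp)
    rw [inter_comm]
    exact inter_mem_nhdsWithin _ (Metric.ball_mem_nhds _ r_pos)
  have B := inter_mem A (chart_source_mem_nhds H x)
  refine ⟨_, B, ?_⟩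
  rintro p ⟨hy, h'y⟩ q ⟨hz, h'z⟩
  rw [IsRiemannianManifold.out (I := I) p q]
  -- The competitor is the straight segment of the chart, pulled back to `M`; it stays in the good
  -- region by convexity.
  let η := ContinuousAffineMap.lineMap (R := ℝ) (extChartAt I x p) (extChartAt I x q)
  set γ := (extChartAt I x).symm ∘ η
  have hη : Icc 0 1 ⊆ ⇑η ⁻¹' ((extChartAt I x).target ∩
        {y | ∀ v : E, ‖mfderiv[range I] (extChartAt I x).symm y v‖ₑ ≤ C * ‖v‖ₑ}) := by
    simp only [← image_subset_iff, ContinuousAffineMap.coe_lineMap_eq,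
     ← segment_eq_image_lineMap, η]
    apply Subset.trans _ hr
    exact ((convex_ball _ _).inter I.convex_range).segment_subset hy hz
  simp only [preimage_inter, subset_inter_iff] at hη
  have η_smooth : CMDiff[Icc 0 1] 1 η := by
    apply ContMDiff.contMDiffOn
    rw [contMDiff_iff_contDiff]
    exact ContinuousAffineMap.contDiff _
  have : riemannianEDist I p q ≤ pathELength I γ 0 1 := by
    apply riemannianEDist_le_pathELength _ _ _ zero_le_one
    · exact (contMDiffOn_extChartAt_symm x).comp η_smooth hη.1
    · simp [γ, η, ContinuousAffineMap.coe_lineMap_eq, h'y]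
    · simp [γ, η, ContinuousAffineMap.coe_lineMap_eq, h'z]
  apply this.trans
  rw [← lintegral_fderiv_lineMap_eq_edist, pathELength_eq_lintegral_mfderivWithin_Icc,
    ← lintegral_const_mul' _ _ ENNReal.coe_ne_top]
  apply setLIntegral_mono' measurableSet_Icc (fun t ht ↦ ?_)
  have : mfderiv[Icc 0 1] γ t =
      (mfderiv[range I] (extChartAt I x).symm (η t)) ∘L (mfderiv[Icc 0 1] η t) := by
    apply mfderivWithin_comp
    · exact mdifferentiableWithinAt_extChartAt_symm (hη.1 ht)
    · exact η_smooth.mdifferentiableOn one_ne_zero t ht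
    · exact hη.1.trans (preimage_mono (extChartAt_target_subset_range x))
    · rw [uniqueMDiffWithinAt_iff_uniqueDiffWithinAt]
      exact uniqueDiffOn_Icc zero_lt_one t ht
  have : mfderiv[Icc 0 1] γ t 1 =
      (mfderiv[range I] (extChartAt I x).symm (η t)) (mfderiv[Icc 0 1] η t 1) := congr($this 1)
  rw [this]
  apply (hη.2 ht _).trans
  simp only [mfderivWithin_eq_fderivWithin]
  exact le_of_eq rfl

/-- Around any point, the distance in the chart is controlled by the Riemannian distance. -/
lemma exists_nhds_edist_extChartAt_le_edist (x : M) :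
    ∃ C > (0 : ℝ≥0), ∃ V ∈ 𝓝 x, ∀ p ∈ V, ∀ q ∈ V,
      edist (extChartAt I x p) (extChartAt I x q) ≤ C * edist p q := by
  rcases eventually_enorm_mfderiv_extChartAt_apply_le I x with ⟨C, C_pos, hC⟩
  refine ⟨C, C_pos, ?_⟩
  obtain ⟨r, r_pos, hr⟩ := EMetric.mem_nhds_iff.1
    (inter_mem hC (extChartAt_source_mem_nhds (I := I) x))
  -- With `p`, `q` within `r / 4` of `x`, a nearly minimizing path from `p` to `q` has length below
  -- `r / 2`, so it never leaves the ball of radius `r`.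
  have hr2 : r / 2 / 2 ≠ 0 := by simpa using r_pos.ne'
  have B := Metric.eball_mem_nhds x (pos_iff_ne_zero.2 hr2)
  refine ⟨_, B, fun p hy q hz => ?_⟩
  have hlt : edist p q < r / 2 := by
    refine (edist_triangle_right p q x).trans_lt ?_
    exact (ENNReal.add_lt_add hy hz).trans_le (ENNReal.add_halves _).le
  refine le_of_forall_gt fun b hb => ?_
  have hC0 : (C : ℝ≥0∞) ≠ 0 := by simpa using C_pos.ne'
  have hb' : edist p q < b / C := by
    rwa [ENNReal.lt_div_iff_mul_lt (Or.inl hC0) (Or.inl ENNReal.coe_ne_top), mul_comm]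
  have hR := lt_min hlt hb'
  rw [IsRiemannianManifold.out (I := I) p q] at hR
  rcases exists_lt_locally_constant_of_riemannianEDist_lt hR zero_lt_one
    with ⟨γ, hγ0, hγ1, γ_smooth, hγ, -⟩
  obtain ⟨hγr, hγb⟩ := lt_min_iff.1 hγ
  have hmem : ∀ t ∈ Icc (0 : ℝ) 1, γ t ∈ {y | ∀ v : TangentSpace I y, ‖(mfderiv% (extChartAt I x) y v : E)‖ₑ ≤ C * ‖v‖ₑ} ∩
      (extChartAt I x).source := by
    intro t ht
    apply hr
    have h1 : edist p (γ t) < r / 2 := by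
      rw [IsRiemannianManifold.out (I := I)]
      refine (riemannianEDist_le_pathELength γ_smooth.contMDiffOn hγ0 rfl ht.1).trans_lt ?_
      exact (pathELength_mono le_rfl ht.2).trans_lt hγr
    have h2 : edist p x < r / 2 := (Metric.mem_eball.1 hy).trans_le (ENNReal.half_le_self)
    rw [Metric.mem_eball]
    refine (edist_triangle_left (γ t) x p).trans_lt ?_
    exact (ENNReal.add_lt_add h1 h2).trans_le (ENNReal.add_halves _).le
  have hsrc : ∀ t ∈ Icc (0 : ℝ) 1, γ t ∈ (chartAt H x).source := fun t ht => by
    simpa [extChartAt_source I x] using (hmem t ht).2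
  let γ' := extChartAt I x ∘ γ
  have hγ' : CMDiff[Icc 0 1] 1 γ' :=
    contMDiffOn_extChartAt.comp (I' := I) (t := (chartAt H x).source) γ_smooth.contMDiffOn hsrc
  have h01 : edist (extChartAt I x p) (extChartAt I x q) = ‖γ' 1 - γ' 0‖ₑ := by
    rw [edist_comm, edist_eq_enorm_sub]
    simp [γ', hγ0, hγ1]
  rw [h01]
  calc
    ‖γ' 1 - γ' 0‖ₑ ≤ ∫⁻ t in Icc 0 1, ‖derivWithin γ' (Icc 0 1) t‖ₑ := by
      apply enorm_sub_le_lintegral_derivWithin_Icc_of_contDiffOn_Icc _ zero_le_one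
      rwa [← contMDiffOn_iff_contDiffOn]
    _ = ∫⁻ t in Icc 0 1, ‖mfderiv[Icc 0 1] γ' t 1‖ₑ := by
      simp_rw [← fderivWithin_derivWithin, mfderivWithin_eq_fderivWithin]
      rfl
    _ ≤ ∫⁻ t in Icc 0 1, C * ‖mfderiv[Icc 0 1] γ t 1‖ₑ := by
      apply setLIntegral_mono' measurableSet_Icc (fun t ht ↦ ?_)
      have : mfderiv[Icc 0 1] γ' t =
          (mfderiv% (extChartAt I x) (γ t)) ∘L (mfderiv[Icc 0 1] γ t) := by
        apply mfderiv_comp_mfderivWithin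
        · exact mdifferentiableAt_extChartAt (hsrc t ht)
        · exact (γ_smooth.mdifferentiable one_ne_zero).mdifferentiableOn _ ht
        · rw [uniqueMDiffWithinAt_iff_uniqueDiffWithinAt]
          exact uniqueDiffOn_Icc zero_lt_one t ht
      have : mfderiv[Icc 0 1] γ' t 1 =
          (mfderiv% (extChartAt I x) (γ t)) (mfderiv[Icc 0 1] γ t 1) := congr($this 1)
      rw [this]
      exact (hmem t ht).1 _
    _ = C * pathELength I γ 0 1 := by
      rw [lintegral_const_mul' _ _ ENNReal.coe_ne_top, pathELength_eq_lintegral_mfderivWithin_Icc]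
    _ < C * (b / C) := by
      gcongr
      exact ENNReal.coe_ne_top
    _ = b := ENNReal.mul_div_cancel hC0 ENNReal.coe_ne_top

end RiemannianChart

/-! ### Compensation of state perturbations by noise shifts in normed spaces -/

section ApproximateControl

variable {U W E : Type*} [NormedAddCommGroup U] [NormedSpace ℝ U] [NormedAddCommGroup W]
  [NormedSpace ℝ W] [NormedAddCommGroup E] [NormedSpace ℝ E]

/-- An operator with dense range approximately solves `L h + A θ = 0`, uniformly over the image of
the unit ball under a compact operator `L`, with `θ` in a fixed member of a dense filtration. -/
lemma exists_approximate_control {L : U →L[ℝ] W} (hL : IsCompactOperator L) {A : E →L[ℝ] W}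
    (hA : DenseRange A) {F : ℕ → Submodule ℝ E} (hF : Monotone F)
    (hFd : Dense (⋃ n, (F n : Set E))) {ε : ℝ} (hε : 0 < ε) :
    ∃ (N : ℕ) (M : ℝ), 0 ≤ M ∧ ∀ h, ∃ θ ∈ F N, ‖θ‖ ≤ M * ‖h‖ ∧ ‖L h + A θ‖ ≤ ε * ‖h‖ := by
  have hcomp : IsCompact (closure (L '' Metric.closedBall 0 1)) :=
    IsCompactOperator.isCompact_closure_image_closedBall (f := (L : U →ₗ[ℝ] W)) hL 1
  have hdense : Dense (A '' ⋃ n, (F n : Set E)) := hA.dense_image A.continuous hFd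
  obtain ⟨N, M, hM, hNM⟩ : ∃ (N : ℕ) (M : ℝ), 0 ≤ M ∧
      ∀ b ∈ closure (L '' Metric.closedBall 0 1), ∃ θ ∈ F N, ‖θ‖ ≤ M ∧ ‖b + A θ‖ ≤ ε := by
    -- Near a given `b` a single `θ` works, by density; finitely many such neighbourhoods suffice,
    -- and `F` is monotone.
    refine hcomp.induction_on (p := fun t => ∃ (N : ℕ) (M : ℝ), 0 ≤ M ∧
      ∀ b ∈ t, ∃ θ ∈ F N, ‖θ‖ ≤ M ∧ ‖b + A θ‖ ≤ ε) ⟨0, 0, le_rfl, by simp⟩ ?_ ?_ ?_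
    · rintro s t hst ⟨N, M, hM, h⟩
      exact ⟨N, M, hM, fun b hb => h b (hst hb)⟩
    · rintro s t ⟨N, M, hM, h⟩ ⟨N', M', hM', h'⟩
      refine ⟨max N N', max M M', le_max_of_le_left hM, ?_⟩
      rintro b (hb | hb)
      · obtain ⟨θ, h1, h2, h3⟩ := h b hb
        exact ⟨θ, hF (le_max_left _ _) h1, h2.trans (le_max_left _ _), h3⟩
      · obtain ⟨θ, h1, h2, h3⟩ := h' b hb
        exact ⟨θ, hF (le_max_right _ _) h1, h2.trans (le_max_right _ _), h3⟩
    · intro b _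
      obtain ⟨w, ⟨θ, hθ, rfl⟩, hw⟩ := hdense.exists_dist_lt (-b) (half_pos hε)
      obtain ⟨N, hN⟩ := mem_iUnion.1 hθ
      refine ⟨Metric.ball b (ε / 2), mem_nhdsWithin_of_mem_nhds (Metric.ball_mem_nhds _ (half_pos hε)),
        N, ‖θ‖, norm_nonneg _, fun b' hb' => ⟨θ, hN, le_rfl, ?_⟩⟩
      have h1 : b' + A θ = (b' - b) - (-b - A θ) := by abel
      rw [h1]
      rw [dist_eq_norm] at hw
      rw [Metric.mem_ball, dist_eq_norm] at hb'
      exact (norm_sub_le _ _).trans (by linarith)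
  refine ⟨N, M, hM, fun h => ?_⟩
  rcases eq_or_ne h 0 with rfl | hne
  · exact ⟨0, zero_mem _, by simp, by simp⟩
  have hpos : 0 < ‖h‖ := norm_pos_iff.2 hne
  obtain ⟨θ, h1, h2, h3⟩ := hNM (L (‖h‖⁻¹ • h)) (subset_closure ⟨_, by
    simp [norm_smul, hpos.ne'], rfl⟩)
  refine ⟨‖h‖ • θ, (F N).smul_mem _ h1, ?_, ?_⟩
  · rw [norm_smul, norm_norm, mul_comm]
    gcongr
  · have h4 : L h + A (‖h‖ • θ) = ‖h‖ • (L (‖h‖⁻¹ • h) + A θ) := by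
      rw [smul_add, map_smul, map_smul, smul_smul, mul_inv_cancel₀ hpos.ne', one_smul]
    rw [h4, norm_smul, norm_norm, mul_comm]
    gcongr

/-- Near a point where the derivative of `Φ` is compact in the first variable and has dense range in
the second one, a change of the first variable can be compensated up to a small relative error by
a shift of the second one, which does not depend on the value of the latter. -/
lemma exists_local_compensation {Φ : U × E → W} {D : U × E →L[ℝ] W} {a : U} {η₀ : E}
    (hΦ : HasStrictFDerivAt Φ D (a, η₀)) (hL : IsCompactOperator (D ∘L .inl ℝ U E))
    (hA : DenseRange (D ∘L .inr ℝ U E)) {F : ℕ → Submodule ℝ E} (hF : Monotone F)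
    (hFd : Dense (⋃ n, (F n : Set E))) {κ : ℝ} (hκ : 0 < κ) {O : Set (U × E)}
    (hO : O ∈ 𝓝 (a, η₀)) :
    ∃ (N : ℕ) (M : ℝ), 0 ≤ M ∧ ∃ V ∈ 𝓝 a, ∃ B ∈ 𝓝 η₀, ∀ x ∈ V, ∀ x' ∈ V, ∃ θ ∈ F N,
      ‖θ‖ ≤ M * ‖x' - x‖ ∧ ∀ η ∈ B, (x, η) ∈ O ∧ (x', η + θ) ∈ O ∧
        ‖Φ (x', η + θ) - Φ (x, η)‖ ≤ κ * ‖x' - x‖ := by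
  obtain ⟨N, M, hM, hNM⟩ := exists_approximate_control hL hA hF hFd (half_pos hκ)
  -- One half of `κ` goes to the approximate control, the other to the remainder of strict
  -- differentiability, since `‖(x' - x, θ)‖ ≤ (1 + M) ‖x' - x‖`. The derivative is frozen at `(a,
  -- η₀)`, so `θ` does not depend on `η`.
  have hc : 0 < κ / 2 / (1 + M) := by positivity
  have hs := hΦ.isLittleO.def hc
  rw [nhds_prod_eq] at hs
  obtain ⟨O', hO', hs⟩ := mem_prod_same_iff.1 hs
  obtain ⟨r, hr, hball⟩ := Metric.mem_nhds_iff.1 (inter_mem hO hO')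
  rw [← ball_prod_same] at hball
  -- Small enough that `‖θ‖ ≤ M * (2 * ρ) ≤ r / 2`, which keeps `η + θ` in the ball of radius `r`.
  set ρ := r / (4 * (M + 1))
  have hρ : 0 < ρ := by positivity
  have hρr : ρ ≤ r / 4 := by
    simp only [ρ]
    gcongr
    linarith
  have hρM : M * (2 * ρ) ≤ r / 2 := by
    have : ρ * (4 * (M + 1)) = r := div_mul_cancel₀ _ (by positivity)
    nlinarith
  refine ⟨N, M, hM, Metric.ball a ρ, Metric.ball_mem_nhds _ hρ, Metric.ball η₀ (r / 2),
    Metric.ball_mem_nhds _ (half_pos hr), fun x hx x' hx' => ?_⟩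
  obtain ⟨θ, hθF, hθ, hLA⟩ := hNM (x' - x)
  refine ⟨θ, hθF, hθ, fun η hη => ?_⟩
  have hxx : ‖x' - x‖ ≤ 2 * ρ := by
    rw [← dist_eq_norm]
    rw [Metric.mem_ball] at hx hx'
    linarith [dist_triangle_right x' x a]
  have h1 : (x, η) ∈ O ∩ O' := hball ⟨Metric.ball_subset_ball (by linarith) hx,
    Metric.ball_subset_ball (by linarith) hη⟩
  have h2 : (x', η + θ) ∈ O ∩ O' := by
    refine hball ⟨Metric.ball_subset_ball (by linarith) hx', ?_⟩
    rw [Metric.mem_ball, dist_eq_norm] at hη ⊢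
    have : η + θ - η₀ = (η - η₀) + θ := by abel
    rw [this]
    have := mul_le_mul_of_nonneg_left hxx hM
    linarith [norm_add_le (η - η₀) θ]
  refine ⟨h1.1, h2.1, ?_⟩
  have h3 : ‖Φ (x', η + θ) - Φ (x, η) - D ((x', η + θ) - (x, η))‖ ≤
      κ / 2 / (1 + M) * ‖((x', η + θ) - (x, η) : U × E)‖ := hs (mk_mem_prod h2.2 h1.2)
  have h4 : D ((x', η + θ) - (x, η)) = (D ∘L .inl ℝ U E) (x' - x) + (D ∘L .inr ℝ U E) θ := by
    simp [← map_add]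
  have h5 : ‖((x', η + θ) - (x, η) : U × E)‖ ≤ (1 + M) * ‖x' - x‖ := by
    have := norm_nonneg (x' - x)
    have := mul_nonneg hM this
    simp only [Prod.mk_sub_mk, add_sub_cancel_left, Prod.norm_mk]
    exact max_le (by linarith) (by linarith)
  have h6 : κ / 2 / (1 + M) * ‖((x', η + θ) - (x, η) : U × E)‖ ≤ κ / 2 * ‖x' - x‖ := by
    calc _ ≤ κ / 2 / (1 + M) * ((1 + M) * ‖x' - x‖) := by gcongr
      _ = _ := by field_simp
  simp only [h4] at h3
  have h7 := norm_add_le (Φ (x', η + θ) - Φ (x, η) -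
    ((D ∘L .inl ℝ U E) (x' - x) + (D ∘L .inr ℝ U E) θ))
    ((D ∘L .inl ℝ U E) (x' - x) + (D ∘L .inr ℝ U E) θ)
  rw [sub_add_cancel] at h7
  linarith

end ApproximateControl

/-! ### Local compensation for the system on `𝓗 × 𝓨` -/

namespace ControlledRDS

variable {𝓗 : Type*} [NormedAddCommGroup 𝓗] [InnerProductSpace ℝ 𝓗]
  {d : ℕ} {𝓨 : Type*} [EMetricSpace 𝓨] [ChartedSpace (EuclideanSpace ℝ (Fin d)) 𝓨]
  {𝓔 : Type*} [NormedAddCommGroup 𝓔] [NormedSpace ℝ 𝓔]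
  {𝓥 : Type*} [NormedAddCommGroup 𝓥] [NormedSpace ℝ 𝓥]

lemma isCompactOperator_prodMap_id {V : Type*} [NormedAddCommGroup V] [NormedSpace ℝ V]
    [ProperSpace V] {ι : 𝓥 →L[ℝ] 𝓗} (hι : IsCompactOperator ι) :
    IsCompactOperator (ι.prodMap (.id ℝ V)) := by
  obtain ⟨K, hK, hK'⟩ := hι
  refine ⟨K ×ˢ Metric.closedBall 0 1, hK.prod (isCompact_closedBall _ _), ?_⟩
  exact prod_mem_nhds hK' (Metric.closedBall_mem_nhds _ one_pos)

/-- A `C²` map is `C²` when read in charts. -/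
lemma contDiffAt_localRep [IsManifold (𝓡 d) ∞ 𝓨] {T : (𝓗 × 𝓨) × 𝓔 → 𝓥 × 𝓨}
    (hT : ContMDiff ((𝓘(ℝ, 𝓗).prod (𝓡 d)).prod 𝓘(ℝ, 𝓔)) (𝓘(ℝ, 𝓥).prod (𝓡 d)) 2 T)
    (x : 𝓗 × 𝓨) (η : 𝓔) :
    ContDiffAt ℝ 2 (localRep (d := d) T x.2 (T (x, η)).2)
      ((x.1, extChartAt (𝓡 d) x.2 x.2), η) := by
  have h := (contMDiffAt_iff.1 (hT (x, η))).2
  have hr : range ((𝓘(ℝ, 𝓗).prod (𝓡 d)).prod 𝓘(ℝ, 𝓔)) = univ :=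
    ModelWithCorners.Boundaryless.range_eq_univ
  rw [hr, contDiffWithinAt_univ] at h
  exact h

lemma isContinuousRiemannianBundle_of_contMDiff [IsManifold (𝓡 d) 1 𝓨]
    [RiemannianBundle (fun y : 𝓨 => TangentSpace (𝓡 d) y)]
    [h : IsContMDiffRiemannianBundle (𝓡 d) ∞ (EuclideanSpace ℝ (Fin d))
      (fun y : 𝓨 => TangentSpace (𝓡 d) y)] :
    IsContinuousRiemannianBundle (EuclideanSpace ℝ (Fin d))
      (fun y : 𝓨 => TangentSpace (𝓡 d) y) := by
  obtain ⟨g, hg, hgi⟩ := h.exists_contMDiff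
  exact ⟨g, hg.continuous, hgi⟩

/-- The map `S` read in the charts at `y₀` (in the source) and at `z₀` (in the target). -/
noncomputable def chartRep (d : ℕ) [ChartedSpace (EuclideanSpace ℝ (Fin d)) 𝓨] (S : (𝓗 × 𝓨) × 𝓔 → 𝓗 × 𝓨)
    (y₀ z₀ : 𝓨) (p : (𝓗 × EuclideanSpace ℝ (Fin d)) × 𝓔) : 𝓗 × EuclideanSpace ℝ (Fin d) :=
  ((S ((p.1.1, (extChartAt (𝓡 d) y₀).symm p.1.2), p.2)).1,
    extChartAt (𝓡 d) z₀ (S ((p.1.1, (extChartAt (𝓡 d) y₀).symm p.1.2), p.2)).2)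

lemma chartRep_apply (S : (𝓗 × 𝓨) × 𝓔 → 𝓗 × 𝓨) {y₀ z₀ : 𝓨} {x : 𝓗 × 𝓨} (η : 𝓔)
    (hx : x.2 ∈ (extChartAt (𝓡 d) y₀).source) :
    chartRep d S y₀ z₀ ((x.1, extChartAt (𝓡 d) y₀ x.2), η) =
      ((S (x, η)).1, extChartAt (𝓡 d) z₀ (S (x, η)).2) := by
  simp only [chartRep, (extChartAt (𝓡 d) y₀).left_inv hx, Prod.mk.eta]

/-- In charts `S` is `ι × id` after a `C²` map, and `ι × id` is compact because the chart space is
finite-dimensional. Density is (ACL), since `mfderiv` is the derivative read in the charts. -/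
lemma exists_hasStrictFDerivAt_chartRep [IsManifold (𝓡 d) ∞ 𝓨]
    {S : (𝓗 × 𝓨) × 𝓔 → 𝓗 × 𝓨} {𝓐 : Set 𝓗} {ι : 𝓥 →L[ℝ] 𝓗} (hR : HypR d S 𝓐 ι) {x₀ : 𝓗 × 𝓨}
    {η₀ : 𝓔}
    (hdense : DenseRange (mfderiv 𝓘(ℝ, 𝓔) (𝓘(ℝ, 𝓗).prod (𝓡 d)) (fun ζ => S (x₀, ζ)) η₀)) :
    ∃ D, HasStrictFDerivAt (chartRep d S x₀.2 (S (x₀, η₀)).2) D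
        ((x₀.1, extChartAt (𝓡 d) x₀.2 x₀.2), η₀) ∧
      IsCompactOperator (D ∘L .inl ℝ (𝓗 × EuclideanSpace ℝ (Fin d)) 𝓔) ∧
      DenseRange (D ∘L .inr ℝ (𝓗 × EuclideanSpace ℝ (Fin d)) 𝓔) := by
  obtain ⟨T, hST, hT, -⟩ := hR.smooth
  have hz : (S (x₀, η₀)).2 = (T (x₀, η₀)).2 := by rw [hST]
  have hRd := contDiffAt_localRep hT x₀ η₀
  obtain ⟨D', hD'⟩ : ∃ D', HasStrictFDerivAt (localRep (d := d) T x₀.2 (T (x₀, η₀)).2) D'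
      ((x₀.1, extChartAt (𝓡 d) x₀.2 x₀.2), η₀) :=
    ⟨_, hRd.hasStrictFDerivAt (by norm_num)⟩
  set J : 𝓥 × EuclideanSpace ℝ (Fin d) →L[ℝ] 𝓗 × EuclideanSpace ℝ (Fin d) :=
    ι.prodMap (.id ℝ _) with hJ
  have hJR : chartRep d S x₀.2 (S (x₀, η₀)).2 =
      fun p => J (localRep (d := d) T x₀.2 (T (x₀, η₀)).2 p) := by
    ext1 p
    simp only [chartRep, localRep, hST]
    rfl
  have hΦ : HasStrictFDerivAt (chartRep d S x₀.2 (S (x₀, η₀)).2) (J ∘L D')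
      ((x₀.1, extChartAt (𝓡 d) x₀.2 x₀.2), η₀) := by
    rw [hJR]
    exact J.hasStrictFDerivAt.comp _ hD'
  refine ⟨J ∘L D', hΦ, IsCompactOperator.comp_clm (f := J)
    (isCompactOperator_prodMap_id hR.compact) (D' ∘L .inl ℝ _ 𝓔), ?_⟩
  have hTx : ContMDiff 𝓘(ℝ, 𝓔) (𝓘(ℝ, 𝓥).prod (𝓡 d)) 2 fun ζ => T (x₀, ζ) :=
    hT.comp (contMDiff_const.prodMk contMDiff_id)
  have hSx : ContMDiff 𝓘(ℝ, 𝓔) (𝓘(ℝ, 𝓗).prod (𝓡 d)) 2 fun ζ => S (x₀, ζ) := by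
    simp only [hST]
    exact (ι.contMDiff.comp (contMDiff_fst.comp hTx)).prodMk (contMDiff_snd.comp hTx)
  have hmd := (hSx η₀).mdifferentiableAt (by norm_num)
  have hw : writtenInExtChartAt 𝓘(ℝ, 𝓔) (𝓘(ℝ, 𝓗).prod (𝓡 d)) η₀ (fun ζ => S (x₀, ζ)) =
      fun ζ => chartRep d S x₀.2 (S (x₀, η₀)).2 ((x₀.1, extChartAt (𝓡 d) x₀.2 x₀.2), ζ) := by
    ext1 ζ
    rw [chartRep_apply S ζ (mem_extChartAt_source x₀.2)]
    simp only [writtenInExtChartAt, extChartAt_prod]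
    rfl
  have hd : HasFDerivAt
      (fun ζ => chartRep d S x₀.2 (S (x₀, η₀)).2 ((x₀.1, extChartAt (𝓡 d) x₀.2 x₀.2), ζ))
      ((J ∘L D') ∘L .inr ℝ _ 𝓔) η₀ :=
    hΦ.hasFDerivAt.comp η₀ (hasFDerivAt_prodMk_right _ η₀)
  have hm : mfderiv 𝓘(ℝ, 𝓔) (𝓘(ℝ, 𝓗).prod (𝓡 d)) (fun ζ => S (x₀, ζ)) η₀ =
      (J ∘L D') ∘L .inr ℝ _ 𝓔 := by
    rw [hmd.mfderiv, hw]
    change fderivWithin ℝ _ (range 𝓘(ℝ, 𝓔)) η₀ = _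
    rw [ModelWithCorners.Boundaryless.range_eq_univ, fderivWithin_univ]
    exact hd.fderiv
  rw [hm] at hdense
  exact hdense

theorem exists_local_contraction [IsManifold (𝓡 d) ∞ 𝓨]
    [RiemannianBundle (fun y : 𝓨 => TangentSpace (𝓡 d) y)]
    [IsContMDiffRiemannianBundle (𝓡 d) ∞ (EuclideanSpace ℝ (Fin d))
      (fun y : 𝓨 => TangentSpace (𝓡 d) y)]
    [IsRiemannianManifold (𝓡 d) 𝓨]
    {S : (𝓗 × 𝓨) × 𝓔 → 𝓗 × 𝓨} (hS : Continuous S) {𝓐 : Set 𝓗} {ι : 𝓥 →L[ℝ] 𝓗}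
    (hR : HypR d S 𝓐 ι) {x₀ : 𝓗 × 𝓨} {η₀ : 𝓔}
    (hdense : DenseRange (mfderiv 𝓘(ℝ, 𝓔) (𝓘(ℝ, 𝓗).prod (𝓡 d)) (fun ζ => S (x₀, ζ)) η₀))
    {F : ℕ → Submodule ℝ 𝓔} (hF : Monotone F) (hFd : Dense (⋃ n, (F n : Set 𝓔))) :
    ∃ (N : ℕ) (M : ℝ), 0 ≤ M ∧ ∃ V ∈ 𝓝 x₀, ∃ B ∈ 𝓝 η₀, ∀ x ∈ V, ∀ x' ∈ V, edist x x' ≠ ⊤ →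
      ∃ θ ∈ F N, ‖θ‖ ≤ M * (edist x x').toReal ∧
        ∀ η ∈ B, edist (S (x, η)) (S (x', η + θ)) ≤ 2⁻¹ * edist x x' := by
  obtain ⟨D, hΦ, hL, hA⟩ := exists_hasStrictFDerivAt_chartRep hR hdense
  have : IsManifold (𝓡 d) 1 𝓨 := IsManifold.of_le (n := ∞) (by simp)
  have : IsContinuousRiemannianBundle (EuclideanSpace ℝ (Fin d))
      (fun y : 𝓨 => TangentSpace (𝓡 d) y) := isContinuousRiemannianBundle_of_contMDiff
  set z₀ := (S (x₀, η₀)).2 with hz₀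
  set φ := extChartAt (𝓡 d) x₀.2 with hφdef
  set ψ := extChartAt (𝓡 d) z₀
  have hφφ : φ.symm (φ x₀.2) = x₀.2 := extChartAt_to_inv x₀.2
  set Φ := chartRep d S x₀.2 z₀
  obtain ⟨C₁, hC₁, V₁, hV₁, h₁⟩ := exists_nhds_edist_extChartAt_le_edist (𝓡 d) x₀.2
  obtain ⟨C₂, hC₂, V₂, hV₂, h₂⟩ := exists_nhds_edist_le_edist_extChartAt (𝓡 d) z₀
  -- Chart coordinates whose image under `S` lies in the domain of the estimates around `z₀`.
  set O : Set ((𝓗 × EuclideanSpace ℝ (Fin d)) × 𝓔) :=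
    {p | (S ((p.1.1, φ.symm p.1.2), p.2)).2 ∈ V₂} with hOdef
  have hO : O ∈ 𝓝 ((x₀.1, φ x₀.2), η₀) := by
    have hc : ContinuousAt (fun p : (𝓗 × EuclideanSpace ℝ (Fin d)) × 𝓔 =>
        (S ((p.1.1, φ.symm p.1.2), p.2)).2) ((x₀.1, φ x₀.2), η₀) := by
      have h1 : ContinuousAt φ.symm (φ x₀.2) := continuousAt_extChartAt_symm x₀.2
      have h2 : ContinuousAt (fun p : (𝓗 × EuclideanSpace ℝ (Fin d)) × 𝓔 => φ.symm p.1.2)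
          ((x₀.1, φ x₀.2), η₀) :=
        ContinuousAt.comp (g := φ.symm)
          (f := fun p : (𝓗 × EuclideanSpace ℝ (Fin d)) × 𝓔 => p.1.2) h1 (by fun_prop)
      have h3 : ContinuousAt (fun p : (𝓗 × EuclideanSpace ℝ (Fin d)) × 𝓔 =>
          (((p.1.1, φ.symm p.1.2), p.2) : (𝓗 × 𝓨) × 𝓔)) ((x₀.1, φ x₀.2), η₀) := by
        fun_prop
      exact (continuous_snd.comp hS).continuousAt.comp h3
    refine hc ?_
    simp only [hφφ, Prod.mk.eta, ← hz₀]
    exact hV₂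
  -- `c` and `c'` are the distortions of the charts in source and target, at least `1` because the
  -- `𝓗`-component is left unchanged. The tolerance in the charts is `1/2` divided by both.
  set c : ℝ≥0 := max 1 C₁
  set c' : ℝ≥0 := max 1 C₂
  have hκ : (0 : ℝ) < 2⁻¹ * (c * c' : ℝ≥0)⁻¹ := by positivity
  obtain ⟨N, M, hM, V, hV, B, hB, hcomp⟩ :=
    exists_local_compensation hΦ hL hA hF hFd hκ hO
  set Ψ : 𝓗 × 𝓨 → 𝓗 × EuclideanSpace ℝ (Fin d) := fun x => (x.1, φ x.2) with hΨ
  have hΨc : ContinuousAt Ψ x₀ := by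
    have h1 : ContinuousAt φ x₀.2 := continuousAt_extChartAt x₀.2
    have h2 : ContinuousAt (fun x : 𝓗 × 𝓨 => φ x.2) x₀ := h1.comp continuousAt_snd
    exact continuousAt_fst.prodMk h2
  have hsrc : (univ : Set 𝓗) ×ˢ (V₁ ∩ φ.source) ∈ 𝓝 x₀ :=
    prod_mem_nhds univ_mem (inter_mem hV₁ (extChartAt_source_mem_nhds x₀.2))
  refine ⟨N, M * c, by positivity, Ψ ⁻¹' V ∩ univ ×ˢ (V₁ ∩ φ.source),
    inter_mem (hΨc hV) hsrc, B, hB, fun x hx x' hx' hfin => ?_⟩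
  obtain ⟨hxV, -, hx1, hxs⟩ := hx
  obtain ⟨hxV', -, hx1', hxs'⟩ := hx'
  obtain ⟨θ, hθF, hθ, hest⟩ := hcomp _ hxV _ hxV'
  have hΨd : edist (Ψ x) (Ψ x') ≤ c * edist x x' := by
    rw [Prod.edist_eq, Prod.edist_eq]
    refine max_le ?_ ?_
    · calc edist x.1 x'.1 ≤ 1 * max (edist x.1 x'.1) (edist x.2 x'.2) := by simp
        _ ≤ _ := by
          gcongr
          exact_mod_cast le_max_left _ _
    · have : edist (φ x.2) (φ x'.2) ≤ C₁ * edist x.2 x'.2 := h₁ _ hx1 _ hx1'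
      refine this.trans ?_
      gcongr
      · exact le_max_right _ _
      · exact le_max_right _ _
  have hΨn : ‖Ψ x' - Ψ x‖ ≤ c * (edist x x').toReal := by
    have := ENNReal.toReal_mono (ENNReal.mul_ne_top ENNReal.coe_ne_top hfin) hΨd
    rw [edist_comm, edist_dist, ENNReal.toReal_ofReal dist_nonneg, dist_eq_norm,
      ENNReal.toReal_mul] at this
    exact this
  refine ⟨θ, hθF, hθ.trans ?_, fun η hη => ?_⟩
  · rw [mul_assoc]
    gcongr
  obtain ⟨hO1, hO2, hΦest⟩ := hest η hη
  have hΨinv : ∀ x : 𝓗 × 𝓨, x.2 ∈ φ.source → (((Ψ x).1, φ.symm (Ψ x).2) : 𝓗 × 𝓨) = x :=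
    fun x hx => Prod.ext rfl (φ.left_inv hx)
  have hΦS : ∀ (x : 𝓗 × 𝓨) (ζ : 𝓔), x.2 ∈ φ.source →
      Φ (Ψ x, ζ) = ((S (x, ζ)).1, ψ (S (x, ζ)).2) := by
    exact fun x ζ hx => chartRep_apply S ζ hx
  simp only [hOdef, mem_ofPred_eq, hΨinv x hxs, hΨinv x' hxs'] at hO1 hO2
  have hSd : edist (S (x, η)) (S (x', η + θ)) ≤ c' * edist (Φ (Ψ x, η)) (Φ (Ψ x', η + θ)) := by
    rw [hΦS x η hxs, hΦS x' _ hxs', Prod.edist_eq, Prod.edist_eq]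
    refine max_le ?_ ?_
    · calc _ ≤ 1 * max (edist (S (x, η)).1 (S (x', η + θ)).1)
            (edist (ψ (S (x, η)).2) (ψ (S (x', η + θ)).2)) := by simp
        _ ≤ _ := by
          gcongr
          exact_mod_cast le_max_left _ _
    · have : edist (S (x, η)).2 (S (x', η + θ)).2 ≤
          C₂ * edist (ψ (S (x, η)).2) (ψ (S (x', η + θ)).2) := h₂ _ hO1 _ hO2
      refine this.trans ?_
      gcongr
      · exact le_max_right _ _
      · exact le_max_right _ _
  have hc0 : (0 : ℝ) < c * c' := by positivity
  have hfinal : (c' : ℝ) * dist (Φ (Ψ x, η)) (Φ (Ψ x', η + θ)) ≤ 2⁻¹ * (edist x x').toReal := by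
    rw [dist_comm, dist_eq_norm]
    calc (c' : ℝ) * ‖Φ (Ψ x', η + θ) - Φ (Ψ x, η)‖
        ≤ c' * (2⁻¹ * (c * c' : ℝ≥0)⁻¹ * (c * (edist x x').toReal)) := by
          gcongr
          exact hΦest.trans (by gcongr)
      _ = 2⁻¹ * (edist x x').toReal := by
          have h1 : (c : ℝ) ≠ 0 := by positivity
          have h2 : (c' : ℝ) ≠ 0 := by positivity
          push_cast
          field_simp
  refine hSd.trans ?_
  rw [edist_dist, ← ENNReal.ofReal_coe_nnreal, ← ENNReal.ofReal_mul (by positivity)]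
  refine (ENNReal.ofReal_le_ofReal hfinal).trans ?_
  rw [ENNReal.ofReal_mul (by positivity), ENNReal.ofReal_toReal hfin,
    ENNReal.ofReal_inv_of_pos two_pos]
  simp

end ControlledRDS

/-! ### Localization in the noise, and local estimates of transition probabilities -/

/-- Compact sets admit finite Lipschitz partitions of unity subordinate to a given choice of
neighbourhoods. -/
lemma IsCompact.exists_lipschitz_partition {E : Type*} [PseudoMetricSpace E] {K : Set E}
    (hK : IsCompact K) (B : E → Set E) (hB : ∀ x ∈ K, B x ∈ 𝓝 x) :
    ∃ (t : Finset E) (χ : E → E → ℝ) (L : ℝ≥0), (∀ i ∈ t, i ∈ K) ∧ (∀ i, LipschitzWith L (χ i)) ∧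
      (∀ i x, 0 ≤ χ i x) ∧ (∀ i ∈ t, ∀ x, χ i x ≤ 1) ∧ (∀ i ∈ t, ∀ x, χ i x ≠ 0 → x ∈ B i) ∧
      ∀ x ∈ K, ∑ i ∈ t, χ i x = 1 := by
  have hr : ∀ i, ∃ r > 0, i ∈ K → Metric.ball i r ⊆ B i := by
    intro i
    by_cases hi : i ∈ K
    · obtain ⟨r, hr, h⟩ := Metric.mem_nhds_iff.1 (hB i hi)
      exact ⟨r, hr, fun _ => h⟩
    · exact ⟨1, one_pos, fun h => absurd h hi⟩
  choose r hr0 hrB using hr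
  obtain ⟨t, htK, hcov⟩ := hK.elim_nhds_subcover (fun i => Metric.ball i (r i))
    (fun i _ => Metric.ball_mem_nhds i (hr0 i))
  set g : E → E → ℝ := fun i x => max 0 (r i - dist x i) with hg
  have hg0 : ∀ i x, 0 ≤ g i x := fun i x => le_max_left _ _
  have hgL : ∀ i x y, |g i x - g i y| ≤ dist x y := by
    intro i x y
    refine (abs_max_sub_max_le_max 0 _ 0 _).trans ?_
    rw [sub_self, abs_zero, sub_sub_sub_cancel_left, abs_sub_comm]
    exact max_le dist_nonneg (abs_dist_sub_le x y i)
  set G : E → ℝ := fun x => ∑ i ∈ t, g i x with hG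
  have hGL : ∀ x y, |G x - G y| ≤ t.card * dist x y := by
    intro x y
    simp only [hG, ← Finset.sum_sub_distrib]
    refine (Finset.abs_sum_le_sum_abs _ _).trans ?_
    simpa using Finset.sum_le_sum fun i (_ : i ∈ t) => hgL i x y
  have hGc : Continuous G := (LipschitzWith.of_dist_le_mul (K := t.card) fun x y => by
    simpa [Real.dist_eq] using hGL x y).continuous
  have hGpos : ∀ x ∈ K, 0 < G x := by
    intro x hx
    obtain ⟨i, hi, hxi⟩ := mem_iUnion₂.1 (hcov hx)
    refine Finset.sum_pos' (fun i _ => hg0 i x) ⟨i, hi, lt_max_of_lt_right ?_⟩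
    exact sub_pos.2 hxi
  obtain ⟨c, hc0, hc⟩ : ∃ c > 0, ∀ x ∈ K, c ≤ G x := by
    rcases K.eq_empty_or_nonempty with rfl | hne
    · exact ⟨1, one_pos, by simp⟩
    · obtain ⟨x₀, hx₀, hmin⟩ := hK.exists_isMinOn hne hGc.continuousOn
      exact ⟨G x₀, hGpos x₀ hx₀, fun x hx => hmin hx⟩
  -- Equal to `G` on `K` but bounded below everywhere, so that the quotients `g i / h` are globally
  -- Lipschitz.
  set h : E → ℝ := fun x => max c (G x) with hh
  have hhc : ∀ x, c ≤ h x := fun x => le_max_left _ _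
  have hhp : ∀ x, 0 < h x := fun x => hc0.trans_le (hhc x)
  have hhL : ∀ x y, |h x - h y| ≤ t.card * dist x y := by
    intro x y
    refine (abs_max_sub_max_le_max c _ c _).trans (max_le ?_ (hGL x y))
    rw [sub_self, abs_zero]
    positivity
  have hgh : ∀ i ∈ t, ∀ x, g i x ≤ h x := fun i hi x =>
    (Finset.single_le_sum (f := fun i => g i x) (fun i _ => hg0 i x) hi).trans (le_max_right _ _)
  classical
  refine ⟨t, fun i x => if i ∈ t then g i x / h x else 0, (1 + t.card) / c.toNNReal, htK, ?_, ?_,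
    ?_, ?_, ?_⟩
  · intro i
    by_cases hi : i ∈ t
    · simp only [hi, if_true]
      refine LipschitzWith.of_dist_le_mul fun x y => ?_
      have h1 : g i x / h x - g i y / h y =
          (g i x - g i y) / h x + (g i y / h y) * ((h y - h x) / h x) := by
        have := (hhp x).ne'
        have := (hhp y).ne'
        field_simp
        ring
      have h2 : |(g i x - g i y) / h x| ≤ dist x y / c := by
        rw [abs_div, abs_of_pos (hhp x)]
        exact div_le_div₀ dist_nonneg (hgL i x y) hc0 (hhc x)
      have h3 : |(h y - h x) / h x| ≤ t.card * dist x y / c := by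
        rw [abs_div, abs_of_pos (hhp x), abs_sub_comm]
        exact div_le_div₀ (by positivity) (hhL x y) hc0 (hhc x)
      have h4 : |g i y / h y| ≤ 1 := by
        rw [abs_of_nonneg (div_nonneg (hg0 i y) (hhp y).le), div_le_one (hhp y)]
        exact hgh i hi y
      rw [Real.dist_eq, h1]
      calc _ ≤ |(g i x - g i y) / h x| + |(g i y / h y)| * |(h y - h x) / h x| := by
            rw [← abs_mul]; exact abs_add_le _ _
        _ ≤ dist x y / c + 1 * (t.card * dist x y / c) := by gcongr
        _ = _ := by
            push_cast
            rw [Real.coe_toNNReal _ hc0.le]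
            ring
    · simp only [hi, if_false]
      exact LipschitzWith.const' 0
  · intro i x
    dsimp only
    split_ifs
    · exact div_nonneg (hg0 i x) (hhp x).le
    · exact le_rfl
  · intro i hi x
    simp only [hi, if_true]
    exact (div_le_one (hhp x)).2 (hgh i hi x)
  · intro i hi x hx
    simp only [hi, if_true] at hx
    refine hrB i (htK i hi) ?_
    by_contra hxb
    rw [Metric.mem_ball, not_lt] at hxb
    exact hx (by simp [hg, max_eq_left (sub_nonpos.2 hxb)])
  · intro x hx
    rw [Finset.sum_congr rfl fun i hi => if_pos hi, ← Finset.sum_div]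
    change G x / h x = 1
    have : h x = G x := max_eq_right (hc x hx)
    rw [this]
    exact div_self (hGpos x hx).ne'

namespace RandomMap

/-- One piece of the comparison of two transition probabilities: the noise is restricted by a
cut-off `χ`, and a shift by `θ` brings the images of `x` and `x'` closer. -/
lemma abs_integral_cutoff_sub_le {Y E : Type*} [EMetricSpace Y] [MeasurableSpace Y] [BorelSpace Y]
    [NormedAddCommGroup E] [MeasurableSpace E] [BorelSpace E] [SecondCountableTopology E]
    {ℓ : Measure E} [IsProbabilityMeasure ℓ] {K : Set E} (hK : MeasurableSet K) (hKℓ : ℓ Kᶜ = 0)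
    {T T' : E → Y} (hT : Continuous T) (hT' : Continuous T') {D : Set Y} (hD : ∀ η ∈ K, T η ∈ D)
    (hD' : ∀ η ∈ K, T' η ∈ D) {χ : E → ℝ} (hχ : Measurable χ) (hχ0 : ∀ η, 0 ≤ χ η)
    (hχ1 : ∀ η, χ η ≤ 1) {θ : E} {C : ℝ}
    (hC : ∀ (g : E → ℝ) (b : ℝ), Measurable g → (∀ v, |g v| ≤ b) →
      |(∫ η, g (η + θ) * χ η ∂ℓ) - ∫ η, g η * χ η ∂ℓ| ≤ C * b) {f : Y → ℝ} (hf : Measurable f)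
    {a r : ℝ} (hfa : ∀ z, |f z| ≤ a) (hr : 0 ≤ r)
    (hfr : ∀ η, χ η ≠ 0 → T η ∈ D → T' (η + θ) ∈ D → |f (T η) - f (T' (η + θ))| ≤ r) :
    |(∫ η, f (T η) * χ η ∂ℓ) - ∫ η, f (T' η) * χ η ∂ℓ| ≤ r * (∫ η, χ η ∂ℓ) + 3 * a * C := by
  have hint : ∀ (g : E → ℝ) (b : ℝ), Measurable g → (∀ v, |g v| ≤ b) →
      Integrable (fun η => g η * χ η) ℓ := by
    intro g b hg hgb
    refine Integrable.of_bound (by fun_prop) b (Eventually.of_forall fun η => ?_)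
    rw [Real.norm_eq_abs, abs_mul, abs_of_nonneg (hχ0 η)]
    exact (mul_le_mul (hgb η) (hχ1 η) (hχ0 η) ((abs_nonneg _).trans (hgb η))).trans (mul_one b).le
  have ha : 0 ≤ a := (abs_nonneg _).trans (hfa (T 0))
  have hTm := hT.measurable
  have hT'm := hT'.measurable
  -- The shift may push the noise out of `K`, where nothing is known about `T'`. As `∫ k χ = 0`, the
  -- bound `hC` applied to `k` shows that the escaping mass is at most `C`; it costs `2 a C`, and
  -- undoing the shift costs `a C`.
  set k : E → ℝ := Kᶜ.indicator 1 with hk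
  have hkm : Measurable k := measurable_one.indicator hK.compl
  have hk1 : ∀ v, |k v| ≤ 1 := fun v => by
    by_cases hv : v ∈ Kᶜ <;> simp [hk, hv]
  have hk0 : ∫ η, k η * χ η ∂ℓ = 0 := by
    refine integral_eq_zero_of_ae ?_
    filter_upwards [measure_eq_zero_iff_ae_notMem.1 hKℓ] with η hη
    simp [hk, hη]
  have hkθ : ∫ η, k (η + θ) * χ η ∂ℓ ≤ C := by
    have := hC k 1 hkm hk1
    rw [hk0, sub_zero, mul_one] at this
    exact (le_abs_self _).trans this
  have h2 := hC (fun η => f (T' η)) a (by fun_prop) (fun v => hfa _)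
  have hi1 : Integrable (fun η => f (T η) * χ η) ℓ :=
    hint (fun η => f (T η)) a (by fun_prop) (fun v => hfa _)
  have hi2 : Integrable (fun η => f (T' (η + θ)) * χ η) ℓ :=
    hint (fun η => f (T' (η + θ))) a (by fun_prop) (fun v => hfa _)
  have hi3 : Integrable (fun η => k (η + θ) * χ η) ℓ :=
    hint (fun η => k (η + θ)) 1 (by fun_prop) (fun v => hk1 _)
  have hiχ : Integrable χ ℓ := by simpa using hint 1 1 measurable_one (by simp)
  have h1 : |(∫ η, f (T η) * χ η ∂ℓ) - ∫ η, f (T' (η + θ)) * χ η ∂ℓ| ≤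
      r * (∫ η, χ η ∂ℓ) + 2 * a * C := by
    rw [← integral_sub hi1 hi2]
    calc _ ≤ ∫ η, (r * χ η + 2 * a * (k (η + θ) * χ η)) ∂ℓ := by
          rw [← Real.norm_eq_abs]
          refine norm_integral_le_of_norm_le
            (g := fun η => r * χ η + 2 * a * (k (η + θ) * χ η))
            ((hiχ.const_mul r).add (hi3.const_mul (2 * a))) ?_
          filter_upwards [measure_eq_zero_iff_ae_notMem.1 hKℓ] with η hη
          have hηK : η ∈ K := by simpa using hη
          rw [← sub_mul, norm_mul, Real.norm_eq_abs, Real.norm_eq_abs, abs_of_nonneg (hχ0 η),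
            ← mul_assoc, ← add_mul]
          rcases eq_or_ne (χ η) 0 with h0 | h0
          · simp [h0]
          refine mul_le_mul_of_nonneg_right ?_ (hχ0 η)
          by_cases hθK : η + θ ∈ K
          · simpa [hk, hθK] using hfr η h0 (hD η hηK) (hD' _ hθK)
          · have h3 : k (η + θ) = 1 := by simp [hk, hθK]
            rw [h3]
            linarith [abs_sub (f (T η)) (f (T' (η + θ))), hfa (T η), hfa (T' (η + θ))]
      _ = r * (∫ η, χ η ∂ℓ) + 2 * a * ∫ η, k (η + θ) * χ η ∂ℓ := by
          rw [integral_add (hiχ.const_mul r) (hi3.const_mul _), integral_const_mul,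
            integral_const_mul]
      _ ≤ _ := by gcongr
  have h3 := abs_sub_le (∫ η, f (T η) * χ η ∂ℓ) (∫ η, f (T' (η + θ)) * χ η ∂ℓ)
    (∫ η, f (T' η) * χ η ∂ℓ)
  linarith

end RandomMap

namespace ControlledRDS

variable {𝓗 : Type*} [NormedAddCommGroup 𝓗] [InnerProductSpace ℝ 𝓗]
  [TopologicalSpace.SeparableSpace 𝓗] [MeasurableSpace 𝓗] [BorelSpace 𝓗]
  {d : ℕ} {𝓨 : Type*} [EMetricSpace 𝓨] [CompactSpace 𝓨]
  [ChartedSpace (EuclideanSpace ℝ (Fin d)) 𝓨] [IsManifold (𝓡 d) ∞ 𝓨]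
  [RiemannianBundle (fun y : 𝓨 => TangentSpace (𝓡 d) y)]
  [IsContMDiffRiemannianBundle (𝓡 d) ∞ (EuclideanSpace ℝ (Fin d))
    (fun y : 𝓨 => TangentSpace (𝓡 d) y)]
  [IsRiemannianManifold (𝓡 d) 𝓨] [MeasurableSpace 𝓨] [BorelSpace 𝓨]
  {𝓔 : Type*} [NormedAddCommGroup 𝓔] [NormedSpace ℝ 𝓔]
  [TopologicalSpace.SeparableSpace 𝓔] [MeasurableSpace 𝓔] [BorelSpace 𝓔]
  {S : (𝓗 × 𝓨) × 𝓔 → 𝓗 × 𝓨} {ℓ : Measure 𝓔} [IsProbabilityMeasure ℓ] {𝓐 : Set 𝓗}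
  {𝓥 : Type*} [NormedAddCommGroup 𝓥] [NormedSpace ℝ 𝓥] {ι : 𝓥 →L[ℝ] 𝓗}

/-- `C` bounds the variation of transition probabilities between points of `V`. -/
def LocalEstimate (S : (𝓗 × 𝓨) × 𝓔 → 𝓗 × 𝓨) (ℓ : Measure 𝓔) (𝓐 : Set 𝓗) (V : Set (𝓗 × 𝓨))
    (C : ℝ) : Prop :=
  ∀ (f : 𝓗 × 𝓨 → ℝ) (a κ : ℝ), Measurable f → (∀ z, |f z| ≤ a) → 0 ≤ κ →
    (∀ z ∈ phaseSet 𝓨 𝓐, ∀ z' ∈ phaseSet 𝓨 𝓐, edist z z' ≠ ⊤ →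
      |f z - f z'| ≤ κ * (edist z z').toReal) →
    ∀ x ∈ V ∩ phaseSet 𝓨 𝓐, ∀ x' ∈ V ∩ phaseSet 𝓨 𝓐, edist x x' ≠ ⊤ →
      |(∫ η, f (S (x, η)) ∂ℓ) - ∫ η, f (S (x', η)) ∂ℓ| ≤ (κ / 2 + C * a) * (edist x x').toReal

/-- The compensating shift depends on the region of the noise, so the support is cut by a partition
of unity and each piece gets its own `θ`. The main terms carry weights `∫ χ i` and add up to `κ /
2`; the total variation errors just sum to `C`. Regularity of `f` is asked only on `𝓧`, as the noise
is kept in its support. -/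
lemma exists_localEstimate (hS : Continuous S)
    (hinv : ∀ x ∈ phaseSet 𝓨 𝓐, ∀ η ∈ ℓ.support, S (x, η) ∈ phaseSet 𝓨 𝓐)
    (hR : HypR d S 𝓐 ι) (hACL : HypACL d S 𝓐 ℓ.support) (hD : HypD ℓ)
    {x₀ : 𝓗 × 𝓨} (hx₀ : x₀ ∈ phaseSet 𝓨 𝓐) :
    ∃ V ∈ 𝓝 x₀, ∃ C, 0 ≤ C ∧ LocalEstimate S ℓ 𝓐 V C := by
  have : SecondCountableTopology 𝓔 := UniformSpace.secondCountable_of_separable 𝓔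
  have : SecondCountableTopology 𝓗 := UniformSpace.secondCountable_of_separable 𝓗
  have : SecondCountableTopology 𝓨 := EMetric.secondCountable_of_sigmaCompact 𝓨
  obtain ⟨F, G, -, hFfin, hFmono, hFdense, h, ⟨c, hc⟩, hprod, hdens⟩ := hD.decomposition
  have hKc := hD.compact_support
  have hKℓ : ℓ ℓ.supportᶜ = 0 := Measure.measure_compl_support
  have hcon := fun η hη => exists_local_contraction hS hR (hACL x₀ hx₀ η hη) hFmono hFdense
  choose! N M hM V hV B hB hcon using hcon
  obtain ⟨t, χ, L, htK, hχL, hχ0, hχ1, hχB, hχsum⟩ := hKc.exists_lipschitz_partition B hB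
  have htrans : ∀ i ∈ t, ∃ C : ℝ, 0 ≤ C ∧ ∀ (θ : F (N i)) (g : 𝓔 → ℝ) (b : ℝ), Measurable g →
      (∀ v, |g v| ≤ b) →
      |(∫ η, g (η + θ) * χ i η ∂ℓ) - ∫ η, g η * χ i η ∂ℓ| ≤ C * b * ‖θ‖ := by
    intro i hi
    obtain ⟨m, ρ, hm, hρ, hρ0, hPρ⟩ := hdens (N i)
    have := hFfin (N i)
    exact exists_translation_bound hKc hKℓ (h (N i))
      (AddMonoidHomClass.continuous_of_bound _ c fun v => (hc (N i) v).1)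
      (AddMonoidHomClass.continuous_of_bound _ c fun v => (hc (N i) v).2)
      (hprod (N i)) hρ hρ0 hPρ (hχL i)
      (fun v => by rw [abs_of_nonneg (hχ0 i v)]; exact hχ1 i hi v)
  choose! C hC0 hC using htrans
  have hCM : ∀ i ∈ t, 0 ≤ C i * M i := fun i hi => mul_nonneg (hC0 i hi) (hM i (htK i hi))
  refine ⟨⋂ i ∈ t, V i, (Filter.biInter_finset_mem t).2 fun i hi => hV i (htK i hi),
    ∑ i ∈ t, 3 * (C i * M i), Finset.sum_nonneg fun i hi => by linarith [hCM i hi], ?_⟩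
  intro f a κ hf hfa hκ hfκ x hx x' hx' hfin
  have ha : 0 ≤ a := (abs_nonneg _).trans (hfa x₀)
  have hSx : ∀ x, Continuous fun η => S (x, η) := fun x => hS.comp (by fun_prop)
  have hint : ∀ (g : 𝓔 → ℝ) (b : ℝ), Measurable g → (∀ v, |g v| ≤ b) → ∀ i ∈ t,
      Integrable (fun η => g η * χ i η) ℓ := by
    intro g b hg hgb i hi
    have := (hχL i).continuous.measurable
    refine Integrable.of_bound (by fun_prop) b (Eventually.of_forall fun η => ?_)
    rw [Real.norm_eq_abs, abs_mul, abs_of_nonneg (hχ0 i η)]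
    exact (mul_le_mul (hgb η) (hχ1 i hi η) (hχ0 i η) ((abs_nonneg _).trans (hgb η))).trans
      (mul_one b).le
  have hsplit : ∀ (g : 𝓔 → ℝ) (b : ℝ), Measurable g → (∀ v, |g v| ≤ b) →
      ∫ η, g η ∂ℓ = ∑ i ∈ t, ∫ η, g η * χ i η ∂ℓ := by
    intro g b hg hgb
    rw [← integral_finsetSum _ (hint g b hg hgb)]
    refine integral_congr_ae ?_
    filter_upwards [Measure.support_mem_ae (μ := ℓ)] with η hη
    rw [← Finset.mul_sum, hχsum η hη, mul_one]
  have hmeas : ∀ x, Measurable fun η => f (S (x, η)) := fun x => hf.comp (hSx x).measurable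
  have hone : ∑ i ∈ t, ∫ η, χ i η ∂ℓ = 1 := by
    have := hsplit 1 1 measurable_one (by simp)
    simpa using this.symm
  set δ := (edist x x').toReal with hδ
  have hδ0 : 0 ≤ δ := ENNReal.toReal_nonneg
  have hpiece : ∀ i ∈ t, |(∫ η, f (S (x, η)) * χ i η ∂ℓ) - ∫ η, f (S (x', η)) * χ i η ∂ℓ| ≤
      κ / 2 * δ * (∫ η, χ i η ∂ℓ) + 3 * (C i * M i) * a * δ := by
    intro i hi
    obtain ⟨θ, hθF, hθM, hθ⟩ := hcon i (htK i hi) x (mem_iInter₂.1 hx.1 i hi) x'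
      (mem_iInter₂.1 hx'.1 i hi) hfin
    have h1 := RandomMap.abs_integral_cutoff_sub_le (ℓ := ℓ) (r := κ / 2 * δ)
      hKc.isClosed.measurableSet hKℓ (hSx x) (hSx x') (D := phaseSet 𝓨 𝓐)
      (fun η hη => hinv x hx.2 η hη)
      (fun η hη => hinv x' hx'.2 η hη) (hχL i).continuous.measurable (hχ0 i) (hχ1 i hi)
      (θ := θ) (C := C i * ‖θ‖) (fun g b hg hgb => by
        have := hC i hi ⟨θ, hθF⟩ g b hg hgb
        refine this.trans (le_of_eq ?_)
        change C i * b * ‖θ‖ = _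
        ring) hf hfa (by positivity) (fun η hη hD1 hD2 => by
        have hle := hθ η (hχB i hi η hη)
        have hne : (2⁻¹ : ℝ≥0∞) * edist x x' ≠ ⊤ := ENNReal.mul_ne_top (by simp) hfin
        refine (hfκ _ hD1 _ hD2 (ne_top_of_le_ne_top hne hle)).trans ?_
        have := ENNReal.toReal_mono hne hle
        rw [ENNReal.toReal_mul, ENNReal.toReal_inv, ENNReal.toReal_ofNat] at this
        calc _ ≤ κ * (2⁻¹ * δ) := by gcongr
          _ = _ := by ring)
    refine h1.trans ?_
    have h2 : C i * ‖θ‖ ≤ C i * (M i * δ) := by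
      have := hC0 i hi
      gcongr
    nlinarith
  rw [hsplit _ a (hmeas x) (fun v => hfa _), hsplit _ a (hmeas x') (fun v => hfa _),
    ← Finset.sum_sub_distrib]
  calc _ ≤ ∑ i ∈ t, (κ / 2 * δ * (∫ η, χ i η ∂ℓ) + 3 * (C i * M i) * a * δ) :=
        (Finset.abs_sum_le_sum_abs _ _).trans (Finset.sum_le_sum hpiece)
    _ = _ := by
        rw [Finset.sum_add_distrib, ← Finset.mul_sum, hone, add_mul, Finset.sum_mul,
          Finset.sum_mul, mul_one]

/-- A Lebesgue number of a finite cover of `𝓧` makes radius and constant uniform. -/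
lemma exists_uniform_localEstimate (hS : Continuous S) (h𝓐 : IsCompact 𝓐)
    (hinv : ∀ x ∈ phaseSet 𝓨 𝓐, ∀ η ∈ ℓ.support, S (x, η) ∈ phaseSet 𝓨 𝓐)
    (hR : HypR d S 𝓐 ι) (hACL : HypACL d S 𝓐 ℓ.support) (hD : HypD ℓ) :
    ∃ δ > 0, ∃ C, 0 ≤ C ∧ ∀ x ∈ phaseSet 𝓨 𝓐,
      LocalEstimate S ℓ 𝓐 (Metric.eball x δ) C := by
  have hcomp : IsCompact (phaseSet 𝓨 𝓐) := h𝓐.prod isCompact_univ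
  have hloc := fun x hx => exists_localEstimate hS hinv hR hACL hD (x₀ := x) hx
  choose! V hV C hC0 hC using hloc
  obtain ⟨t, ht, hcov⟩ := hcomp.elim_nhds_subcover (fun x => interior (V x))
    (fun x hx => interior_mem_nhds.2 (hV x hx))
  obtain ⟨δ, hδ, hδV⟩ := lebesgue_number_lemma_of_emetric hcomp
    (c := fun i : t => interior (V i)) (fun i => isOpen_interior) (fun x hx => by
      obtain ⟨i, hi, h⟩ := mem_iUnion₂.1 (hcov hx)
      exact mem_iUnion.2 ⟨⟨i, hi⟩, h⟩)
  refine ⟨δ, hδ, ∑ i ∈ t, C i, Finset.sum_nonneg fun i hi => hC0 i (ht i hi), ?_⟩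
  intro x hx f a κ hf hfa hκ hfκ y hy y' hy' hfin
  obtain ⟨i, hi⟩ := hδV x hx
  have hsub := hi.trans interior_subset
  refine (hC i (ht i i.2) f a κ hf hfa hκ hfκ y ⟨hsub hy.1, hy.2⟩ y' ⟨hsub hy'.1, hy'.2⟩
    hfin).trans ?_
  have ha : 0 ≤ a := (abs_nonneg _).trans (hfa x)
  gcongr
  exact Finset.single_le_sum (f := C) (fun i hi => hC0 i (ht i hi)) i.2

end ControlledRDS

/-! ### The dual-Lipschitz norm, and restriction to `𝓧` and to the support of the noise -/

namespace RandomMap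

lemma abs_sub_le_of_lipNorm_le_one {X : Type*} [EMetricSpace X] {f : X → ℝ}
    (hf : ControlledRDS.lipNorm f ≤ 1) : (∀ x, |f x| ≤ 1) ∧ ∀ x y, edist (f x) (f y) ≤ edist x y := by
  unfold ControlledRDS.lipNorm at hf
  refine ⟨fun x => ?_, fun x y => ?_⟩
  · have h1 : ‖f x‖ₑ ≤ 1 := (le_iSup (fun u => ‖f u‖ₑ) x).trans (le_self_add.trans hf)
    rw [← Real.norm_eq_abs]
    rw [← ofReal_norm] at h1
    simpa using h1
  · rcases eq_or_ne x y with rfl | hxy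
    · simp
    rcases eq_or_ne (edist x y) ⊤ with ht | ht
    · simp [ht]
    have h1 : edist (f x) (f y) / edist x y ≤ 1 :=
      (le_iSup₂ (f := fun u v => edist (f u) (f v) / edist u v) x y).trans (le_add_self.trans hf)
    rwa [ENNReal.div_le_iff (edist_pos.2 hxy).ne' ht, one_mul] at h1

/-- The constant `2` is the oscillation allowed by `|f| ≤ 1`; at small distances `1 ≤ K` suffices.
-/
lemma truncLip_of_lipNorm_le_one {X : Type*} [EMetricSpace X] {f : X → ℝ} {K : ℝ≥0} (hK : 1 ≤ K)
    (hf : ControlledRDS.lipNorm f ≤ 1) : TruncLip K 2 f := by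
  obtain ⟨h1, h2⟩ := abs_sub_le_of_lipNorm_le_one hf
  intro x y
  rcases le_or_gt 1 ((K : ℝ≥0∞) * edist x y) with hxy | hxy
  · rw [truncDist_of_one_le hxy]
    linarith [abs_sub (f x) (f y), h1 x, h1 y]
  · rw [truncDist_of_lt_one hxy]
    have hne : edist x y ≠ ⊤ := by
      intro hT
      rw [hT, ENNReal.mul_top (by simpa using (one_pos.trans_le hK).ne')] at hxy
      simp at hxy
    have h3 := ENNReal.toReal_mono hne (h2 x y)
    rw [edist_dist, ENNReal.toReal_ofReal dist_nonneg, Real.dist_eq] at h3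
    have h4 : (1 : ℝ) ≤ K := by exact_mod_cast hK
    have h5 : (0 : ℝ) ≤ (edist x y).toReal := ENNReal.toReal_nonneg
    nlinarith

end RandomMap

namespace ControlledRDS

open RandomMap

section Restriction

variable {𝓗 𝓨 𝓔 : Type*} [TopologicalSpace 𝓔] [MeasurableSpace 𝓔]
  {S : (𝓗 × 𝓨) × 𝓔 → 𝓗 × 𝓨} {ℓ : Measure 𝓔} {𝓐 : Set 𝓗}

/-- The map `S` restricted to the invariant set and to the support of the noise. -/
def restrictedMap (hinv : ∀ x ∈ phaseSet 𝓨 𝓐, ∀ η ∈ ℓ.support, S (x, η) ∈ phaseSet 𝓨 𝓐)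
    (p : phaseSet 𝓨 𝓐 × ℓ.support) : phaseSet 𝓨 𝓐 :=
  ⟨S (p.1, p.2), hinv _ p.1.2 _ p.2.2⟩

/-- The law of the noise, as a measure on its support. -/
noncomputable def noiseLaw (ℓ : Measure 𝓔) : Measure ℓ.support := ℓ.comap Subtype.val

variable (hinv : ∀ x ∈ phaseSet 𝓨 𝓐, ∀ η ∈ ℓ.support, S (x, η) ∈ phaseSet 𝓨 𝓐)

lemma orbit_restrictedMap (x : phaseSet 𝓨 𝓐) {ζ : ℕ → 𝓔} {ζ' : ℕ → ℓ.support} {n : ℕ}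
    (h : ∀ k < n, ζ k = ζ' k) : ((orbit (restrictedMap hinv) x ζ' n : phaseSet 𝓨 𝓐) : 𝓗 × 𝓨) =
      trajectory S x ζ n := by
  induction n with
  | zero => rfl
  | succ n ih =>
    simp only [orbit, trajectory, restrictedMap]
    rw [ih fun k hk => h k (hk.trans n.lt_succ_self), h n n.lt_succ_self]

lemma continuous_restrictedMap [TopologicalSpace 𝓗] [TopologicalSpace 𝓨] (hS : Continuous S) :
    Continuous (restrictedMap hinv) :=
  (hS.comp (by fun_prop)).subtype_mk _

variable [BorelSpace 𝓔] [HereditarilyLindelofSpace 𝓔]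

lemma noiseLaw_apply (A : Set ℓ.support) :
    noiseLaw ℓ A = ℓ (Subtype.val '' A) :=
  comap_subtype_coe_apply Measure.isClosed_support.measurableSet _ _

lemma integral_noiseLaw (g : 𝓔 → ℝ) : ∫ ζ : ℓ.support, g ζ ∂(noiseLaw ℓ) = ∫ η, g η ∂ℓ := by
  rw [noiseLaw, integral_subtype_comap Measure.isClosed_support.measurableSet,
    Measure.restrict_eq_self_of_ae_mem (show ∀ᵐ η ∂ℓ, η ∈ ℓ.support from Measure.support_mem_ae)]

instance isProbabilityMeasure_noiseLaw [IsProbabilityMeasure ℓ] :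
    IsProbabilityMeasure (noiseLaw ℓ) := by
  refine ⟨?_⟩
  rw [noiseLaw_apply, image_univ, Subtype.range_coe,
    ← prob_compl_eq_zero_iff Measure.isClosed_support.measurableSet]
  exact Measure.measure_compl_support

/-- The reason for restricting the noise to its support: the controls of (AC) then give events of
positive probability. -/
instance isOpenPosMeasure_noiseLaw : (noiseLaw ℓ).IsOpenPosMeasure := by
  refine ⟨fun U hU hne => ?_⟩
  obtain ⟨O, hO, rfl⟩ := isOpen_induced_iff.1 hU
  obtain ⟨⟨η, hη⟩, hηO⟩ := hne
  rw [noiseLaw_apply, Subtype.image_preimage_coe]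
  have h1 := Measure.mem_support_iff_forall η |>.1 hη O (hO.mem_nhds hηO)
  rw [inter_comm, measure_inter_conull Measure.measure_compl_support]
  exact h1.ne'

lemma markovDual_eq_markovPush [TopologicalSpace 𝓗] [MeasurableSpace 𝓗] [BorelSpace 𝓗]
    [TopologicalSpace 𝓨] [MeasurableSpace 𝓨] [BorelSpace 𝓨] [SecondCountableTopology 𝓗]
    [SecondCountableTopology 𝓨] [SecondCountableTopology 𝓔] [IsProbabilityMeasure ℓ]
    (hS : Continuous S) (hm : MeasurableSet (phaseSet 𝓨 𝓐)) (ν : Measure (phaseSet 𝓨 𝓐)) :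
    markovDual S ℓ 𝓐 ν = markovPush (restrictedMap hinv) (noiseLaw ℓ) ν := by
  have hsm := (continuous_restrictedMap hinv hS).measurable
  have htr : ∀ (x : phaseSet 𝓨 𝓐) (A : Set (phaseSet 𝓨 𝓐)), MeasurableSet A →
      transition S ℓ 𝓐 x A = noiseLaw ℓ (Prod.mk x ⁻¹' (restrictedMap hinv ⁻¹' A)) := by
    intro x A hA
    have hA' := hm.subtype_image hA
    have hSx : Measurable fun ζ => S (x, ζ) := (hS.comp (by fun_prop)).measurable
    rw [transition, comap_subtype_coe_apply hm, Measure.map_apply hSx hA',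
      noiseLaw_apply]
    rw [← measure_inter_conull (s := (fun ζ => S (x, ζ)) ⁻¹' (Subtype.val '' A))
      (Measure.measure_compl_support (μ := ℓ))]
    congr 1
    ext η
    constructor
    · rintro ⟨⟨z, hz, hzη⟩, hη⟩
      refine ⟨⟨η, hη⟩, ?_, rfl⟩
      have : restrictedMap hinv (x, ⟨η, hη⟩) = z := Subtype.ext hzη.symm
      simpa [this] using hz
    · rintro ⟨ζ, hζ, rfl⟩
      exact ⟨⟨_, hζ, rfl⟩, ζ.2⟩
  have hmeas : Measurable (transition S ℓ 𝓐) := by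
    refine Measure.measurable_of_measurable_coe _ fun A hA => ?_
    simp only [htr _ A hA]
    exact measurable_measure_prodMk_left (hsm hA)
  ext A hA
  rw [markovDual, markovPush, Measure.bind_apply hA hmeas.aemeasurable,
    Measure.map_apply hsm hA, Measure.prod_apply (hsm hA)]
  exact lintegral_congr fun x => htr x A hA

end Restriction

end ControlledRDS

/-! ### Choice of the truncation constant, and the theorem -/

open ControlledRDS RandomMap in
/-- Contraction of the truncated distance by the Markov operator, at small distances. -/
lemma ControlledRDS.exists_truncDist_contraction
    {𝓗 : Type*} [NormedAddCommGroup 𝓗] [InnerProductSpace ℝ 𝓗]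
    [TopologicalSpace.SeparableSpace 𝓗] [MeasurableSpace 𝓗] [BorelSpace 𝓗]
    {d : ℕ} {𝓨 : Type*} [EMetricSpace 𝓨] [CompactSpace 𝓨]
    [ChartedSpace (EuclideanSpace ℝ (Fin d)) 𝓨] [IsManifold (𝓡 d) ∞ 𝓨]
    [RiemannianBundle (fun y : 𝓨 => TangentSpace (𝓡 d) y)]
    [IsContMDiffRiemannianBundle (𝓡 d) ∞ (EuclideanSpace ℝ (Fin d))
      (fun y : 𝓨 => TangentSpace (𝓡 d) y)]
    [IsRiemannianManifold (𝓡 d) 𝓨] [MeasurableSpace 𝓨] [BorelSpace 𝓨]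
    {𝓔 : Type*} [NormedAddCommGroup 𝓔] [NormedSpace ℝ 𝓔]
    [TopologicalSpace.SeparableSpace 𝓔] [MeasurableSpace 𝓔] [BorelSpace 𝓔]
    {S : (𝓗 × 𝓨) × 𝓔 → 𝓗 × 𝓨} (hS : Continuous S) {ℓ : Measure 𝓔} [IsProbabilityMeasure ℓ]
    {𝓐 : Set 𝓗} (h𝓐 : IsCompact 𝓐)
    (hinv : ∀ x ∈ phaseSet 𝓨 𝓐, ∀ η ∈ ℓ.support, S (x, η) ∈ phaseSet 𝓨 𝓐)
    {𝓥 : Type*} [NormedAddCommGroup 𝓥] [NormedSpace ℝ 𝓥] {ι : 𝓥 →L[ℝ] 𝓗}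
    (hR : HypR d S 𝓐 ι) (hACL : HypACL d S 𝓐 ℓ.support) (hD : HypD ℓ) :
    ∃ K : ℝ≥0, 1 ≤ K ∧ ∀ (a : ℝ) (f : phaseSet 𝓨 𝓐 → ℝ), 0 ≤ a → TruncLip K a f → ∀ x y,
      truncDist K x y < 1 →
        |markovOp (restrictedMap hinv) (noiseLaw ℓ) f x -
          markovOp (restrictedMap hinv) (noiseLaw ℓ) f y| ≤ 3 / 4 * a * truncDist K x y := by
  classical
  have : SecondCountableTopology 𝓔 := UniformSpace.secondCountable_of_separable 𝓔
  have : SecondCountableTopology 𝓗 := UniformSpace.secondCountable_of_separable 𝓗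
  have : SecondCountableTopology 𝓨 := EMetric.secondCountable_of_sigmaCompact 𝓨
  have : CompactSpace ℓ.support := isCompact_iff_compactSpace.1 hD.compact_support
  have : CompactSpace (phaseSet 𝓨 𝓐) := isCompact_iff_compactSpace.1 (h𝓐.prod isCompact_univ)
  have hm : MeasurableSet (phaseSet 𝓨 𝓐) := (h𝓐.prod isCompact_univ).isClosed.measurableSet
  obtain ⟨δ, hδ, C, hC0, hC⟩ := exists_uniform_localEstimate hS h𝓐 hinv hR hACL hD
  have hδ' : (min δ 1)⁻¹ ≠ ⊤ := ENNReal.inv_ne_top.2 (lt_min hδ one_pos).ne'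
  -- `K ≥ 1 / δ` turns `d_K < 1` into `d < δ`, where the local estimate holds; `K ≥ 4 C` absorbs the
  -- total variation error; `K ≥ 1` lets `d_K` dominate unit Lipschitz functions later.
  set K : ℝ≥0 := max 1 (max (min δ 1)⁻¹.toNNReal (4 * C).toNNReal)
  have hK1 : 1 ≤ K := le_max_left _ _
  have hKδ : (min δ 1)⁻¹ ≤ K := by
    rw [← ENNReal.coe_toNNReal hδ']
    exact_mod_cast (le_max_left _ _).trans (le_max_right _ _)
  have hKC : 4 * C ≤ K := by
    refine (Real.le_coe_toNNReal _).trans ?_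
    exact_mod_cast (le_max_right _ _).trans (le_max_right 1 _)
  refine ⟨K, hK1, fun a f ha hf x y hxy => ?_⟩
  have hlt : (K : ℝ≥0∞) * edist x y < 1 := by
    by_contra hge
    exact hxy.ne (truncDist_of_one_le (not_lt.1 hge))
  have hK0 : (K : ℝ≥0∞) ≠ 0 := by simpa using (one_pos.trans_le hK1).ne'
  have hlt' : edist x y < δ := by
    have h1 : edist x y < (K : ℝ≥0∞)⁻¹ := by
      rw [← one_div, ENNReal.lt_div_iff_mul_lt (Or.inl hK0) (Or.inl ENNReal.coe_ne_top), mul_comm]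
      exact hlt
    exact h1.trans_le ((ENNReal.inv_le_iff_inv_le.1 hKδ).trans (min_le_left _ _))
  have hfin : edist (x : 𝓗 × 𝓨) y ≠ ⊤ := ne_top_of_lt hlt'
  -- Subtracting `f x` leaves differences unchanged and bounds the supremum by the oscillation `a`.
  set g : 𝓗 × 𝓨 → ℝ := fun z => if h : z ∈ phaseSet 𝓨 𝓐 then f ⟨z, h⟩ - f x else 0 with hg
  have hgf : ∀ z (h : z ∈ phaseSet 𝓨 𝓐), g z = f ⟨z, h⟩ - f x := fun z h => dif_pos h
  have hgm : Measurable g :=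
    Measurable.dite (hf.continuous.measurable.sub_const _) measurable_const hm
  have hga : ∀ z, |g z| ≤ a := by
    intro z
    by_cases h : z ∈ phaseSet 𝓨 𝓐
    · rw [hgf z h]
      exact hf.abs_sub_le ha _ _
    · simpa [hg, h] using ha
  have hgκ : ∀ z ∈ phaseSet 𝓨 𝓐, ∀ z' ∈ phaseSet 𝓨 𝓐, edist z z' ≠ ⊤ →
      |g z - g z'| ≤ a * K * (edist z z').toReal := by
    intro z hz z' hz' hfin
    rw [hgf z hz, hgf z' hz', sub_sub_sub_cancel_right, mul_assoc]
    refine (hf _ _).trans ?_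
    gcongr
    exact truncDist_le hfin
  have hop : ∀ w : phaseSet 𝓨 𝓐, markovOp (restrictedMap hinv) (noiseLaw ℓ) f w - f x =
      ∫ η, g (S (w, η)) ∂ℓ := by
    intro w
    have hi := integrable_comp_randomMap (m := noiseLaw ℓ) (continuous_restrictedMap hinv hS)
      hf.continuous w
    rw [← integral_noiseLaw fun η => g (S (w, η))]
    have h1 : ∀ ζ : ℓ.support, g (S (w, ζ)) = f (restrictedMap hinv (w, ζ)) - f x :=
      fun ζ => hgf _ _
    simp only [h1]
    rw [integral_sub hi (integrable_const _)]
    simp [markovOp]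
  have h1 := hC x x.2 g a (a * K) hgm hga (by positivity) hgκ x
    ⟨Metric.mem_eball_self hδ, x.2⟩ y ⟨by rw [Metric.mem_eball, edist_comm]; exact hlt', y.2⟩ hfin
  rw [← hop, ← hop, sub_sub_sub_cancel_right] at h1
  refine h1.trans ?_
  rw [truncDist_of_lt_one hlt]
  have h2 : (0 : ℝ) ≤ (edist x y).toReal := ENNReal.toReal_nonneg
  have h3 : C * a ≤ K / 4 * a := by gcongr; linarith
  calc _ ≤ (a * K / 2 + K / 4 * a) * (edist x y).toReal := by
        change (a * K / 2 + C * a) * (edist x y).toReal ≤ _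
        gcongr
    _ = _ := by ring

theorem theorem4p1
    -- the separable Hilbert space `𝓗`
    {𝓗 : Type*} [NormedAddCommGroup 𝓗] [InnerProductSpace ℝ 𝓗] [CompleteSpace 𝓗]
    [TopologicalSpace.SeparableSpace 𝓗] [MeasurableSpace 𝓗] [BorelSpace 𝓗]
    -- the compact Riemannian manifold `𝓨`, without boundary
    {d : ℕ} {𝓨 : Type*} [EMetricSpace 𝓨] [CompactSpace 𝓨]
    [ChartedSpace (EuclideanSpace ℝ (Fin d)) 𝓨] [IsManifold (𝓡 d) ∞ 𝓨]
    [RiemannianBundle (fun y : 𝓨 => TangentSpace (𝓡 d) y)]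
    [IsContMDiffRiemannianBundle (𝓡 d) ∞ (EuclideanSpace ℝ (Fin d))
      (fun y : 𝓨 => TangentSpace (𝓡 d) y)]
    [IsRiemannianManifold (𝓡 d) 𝓨] [MeasurableSpace 𝓨] [BorelSpace 𝓨]
    -- the separable Banach space `𝓔`
    {𝓔 : Type*} [NormedAddCommGroup 𝓔] [NormedSpace ℝ 𝓔] [CompleteSpace 𝓔]
    [TopologicalSpace.SeparableSpace 𝓔] [MeasurableSpace 𝓔] [BorelSpace 𝓔]
    -- the random dynamical system, the law `ℓ` of the noise, and the invariant set
    (S : (𝓗 × 𝓨) × 𝓔 → 𝓗 × 𝓨) (hS : Continuous S)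
    (ℓ : Measure 𝓔) [IsProbabilityMeasure ℓ]
    (𝓐 : Set 𝓗) (h𝓐 : IsCompact 𝓐)
    (hinv : ∀ x ∈ ControlledRDS.phaseSet 𝓨 𝓐, ∀ η ∈ ℓ.support,
      S (x, η) ∈ ControlledRDS.phaseSet 𝓨 𝓐)
    -- the hypotheses (R), (AC), (ACL) and (D)
    {𝓥 : Type*} [NormedAddCommGroup 𝓥] [NormedSpace ℝ 𝓥] [CompleteSpace 𝓥] (ι : 𝓥 →L[ℝ] 𝓗)
    (hR : ControlledRDS.HypR d S 𝓐 ι)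
    (hAC : ControlledRDS.HypAC S 𝓐 ℓ.support)
    (hACL : ControlledRDS.HypACL d S 𝓐 ℓ.support)
    (hD : ControlledRDS.HypD ℓ) :
    ∃ μ : Measure (ControlledRDS.phaseSet 𝓨 𝓐),
      ControlledRDS.IsStationary S ℓ 𝓐 μ ∧
      (∀ μ' : Measure (ControlledRDS.phaseSet 𝓨 𝓐),
        ControlledRDS.IsStationary S ℓ 𝓐 μ' → μ' = μ) ∧
      ∃ γ C : ℝ, 0 < γ ∧ 0 < C ∧
        ∀ ν : Measure (ControlledRDS.phaseSet 𝓨 𝓐), IsProbabilityMeasure ν → ∀ k : ℕ,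
          ControlledRDS.dualLipDist ((ControlledRDS.markovDual S ℓ 𝓐)^[k] ν) μ ≤
            ENNReal.ofReal (C * Real.exp (-γ * k)) := by
  
  have : SecondCountableTopology 𝓔 := UniformSpace.secondCountable_of_separable 𝓔
  have : SecondCountableTopology 𝓗 := UniformSpace.secondCountable_of_separable 𝓗
  have : SecondCountableTopology 𝓨 := EMetric.secondCountable_of_sigmaCompact 𝓨
  have : CompactSpace ℓ.support := isCompact_iff_compactSpace.1 hD.compact_support
  have hcomp : IsCompact (ControlledRDS.phaseSet 𝓨 𝓐) := h𝓐.prod isCompact_univ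
  have : CompactSpace (ControlledRDS.phaseSet 𝓨 𝓐) := isCompact_iff_compactSpace.1 hcomp
  obtain ⟨K, hK1, hloc⟩ :=
    ControlledRDS.exists_truncDist_contraction hS h𝓐 hinv hR hACL hD
  have hs := ControlledRDS.continuous_restrictedMap hinv hS
  have hK : 0 < K := one_pos.trans_le hK1
  have hdual := ControlledRDS.markovDual_eq_markovPush hinv hS hcomp.isClosed.measurableSet
  obtain ⟨c, hc, -⟩ := hR.fixedPoint
  -- This precision makes the truncated distance to `c` at most `1/8`, below the required `1/4`.
  obtain ⟨n, hn, hreach⟩ := hAC (1 / (8 * K)) (by positivity)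
  have hreach' : ∀ x, ∃ ζ, RandomMap.truncDist K
      (RandomMap.orbit (ControlledRDS.restrictedMap hinv) x ζ n) ⟨c, hc⟩ < 1 / 4 := by
    intro x
    obtain ⟨ζ, hζ, hd⟩ := hreach x x.2 c hc
    -- Controls after time `n` play no role; `ζ 0` is a default value in the support because `n ≥
    -- 1`.
    let ζ' : ℕ → ℓ.support := fun k => if h : k < n then ⟨ζ k, hζ k h⟩ else ⟨ζ 0, hζ 0 hn⟩
    refine ⟨ζ', ?_⟩
    rw [← ControlledRDS.orbit_restrictedMap hinv x (ζ' := ζ') fun k hk => by simp [ζ', hk]] at hd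
    refine (RandomMap.truncDist_le (ne_top_of_le_ne_top ENNReal.ofReal_ne_top hd)).trans_lt ?_
    have h1 := ENNReal.toReal_mono ENNReal.ofReal_ne_top hd
    rw [ENNReal.toReal_ofReal (by positivity)] at h1
    have hK' : (0 : ℝ) < K := by exact_mod_cast hK
    calc _ ≤ (K : ℝ) * (1 / (8 * K)) := mul_le_mul_of_nonneg_left h1 hK'.le
      _ = 1 / 8 := by field_simp
      _ < 1 / 4 := by norm_num
  obtain ⟨μ, ⟨hμp, hμ⟩, γ, C, hγ, hC, hmix⟩ :=
    RandomMap.exists_exponentialMixing hs hloc hK hn hreach'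
  refine ⟨μ, ⟨hμp, (hdual μ).trans hμ⟩, ?_, γ, C * 2, hγ, by positivity, ?_⟩
  · rintro μ' ⟨hμ'p, hμ'⟩
    rw [hdual] at hμ'
    refine RandomMap.measure_ext_of_truncLip hK fun a f ha hf => ?_
    have h0 : |(∫ x, f x ∂μ') - ∫ x, f x ∂μ| ≤ 0 :=
      ge_of_tendsto' (RandomMap.tendsto_mul_exp_neg_mul hγ C a) fun k => by
        have := hmix μ' hμ'p a f ha hf k
        rwa [Function.iterate_fixed hμ'] at this
    exact sub_eq_zero.1 (abs_nonpos_iff.1 h0)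
  · intro ν hν k
    rw [funext hdual]
    refine iSup_le fun f => ENNReal.ofReal_le_ofReal ?_
    refine (hmix ν hν 2 f.1 zero_le_two (RandomMap.truncLip_of_lipNorm_le_one hK1 f.2) k).trans_eq ?_
    ring
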